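/- Let $\mathcal X$ be a non-empty set (of arbitrary cardinality) and $\mathcal H$ a finite-dimensional complex Hilbert space with set of density operators $\mathcal D(\mathcal H)$. A channel is a map $W:\mathcal X\to\mathcal D(\mathcal H)$; its memoryless extension $W^{\otimes n}:\mathcal X^n\to\mathcal D(\mathcal H^{\otimes n})$ is $W^{\otimes n}(x_1,\dots,x_n)=W(x_1)\otimes\cdots\otimes W(x_n)$. A code for a channel $V:\mathcal Y\to\mathcal D(\mathcal K)$ is a triple $\mathcal C=(M,\varphi,\Pi)$ with an integer $|\mathcal C|:=M\ge 1$, a map $\varphi:\{1,\dots,M\}\to\mathcal Y$ and a POVM $\Pi=(\Pi_m)_{m=1}^M$ on $\mathcal K$ ($\Pi_m\ge 0$, $\sum_m\Pi_m=I$); its average error probability is $p_e(\mathcal C,V)=\frac1M\sum_{m=1}^M\bigl(1-\operatorname{Tr}V(\varphi(m))\Pi_m\bigr)$. For a sequence of channels $\mathbf W=(W^{(n)})_n$, the strong converse capacity $C^*(\mathbf W)$ is the infimum of all real $R$ such that every sequence of codes $\mathcal C^{(n)}$ for $W^{(n)}$ with $\liminf_{n\to\infty}\frac1n\log|\mathcal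 C^{(n)}|\ge R$ satisfies $p_e(\mathcal C^{(n)},W^{(n)})\to1$. Write $C^*(W)$ when $W^{(n)}=W^{\otimes n}$. Logarithms are to base $2$. For a finitely supported probability distribution $p$ on $\mathcal X$, let $\rho_{\mathcal XB}(p)=\sum_x p(x)|x\rangle\langle x|\otimes W(x)$, $\rho_{\mathcal X}(p)=\sum_x p(x)|x\rangle\langle x|$, and $$\chi(W,p)=\inf_{\sigma\in\mathcal D(\mathcal H)}D\bigl(\rho_{\mathcal XB}(p)\,\big\|\,\rho_{\mathcal X}(p)\otimes\sigma\bigr),\qquad \chi^*(W)=\sup_p\chi(W,p),$$ where $D(\rho\|\sigma)=\operatorname{Tr}\rho(\log\rho-\log\sigma)$ if $\operatorname{supp}\rho\subseteq\operatorname{supp}\sigma$ and $D(\rho\|\sigma)=+\infty$ otherwise. Let $W_1,\dots,W_K:\mathcal X\to\mathcal D(\mathcal H)$ be channels, let $\gamma_1,\dots,\gamma_K>0$ with $\sum_i\gamma_i=1$, and let $\mathbf W$ be the averaged channel $W^{(n)}=\sum_{i=1}^K\gamma_iW_i^{\otimes n}$. Then $$C^*(\mathbf W)=\max_{1\le i\le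 K}\chi^*(W_i)=\max_{1\le i\le K}C^*(W_i)=\sup_{p}\max_{1\le i\le K}\chi(W_i,p),$$ where the supremum is over all finitely supported probability distributions $p$ on $\mathcal X$. -/

import Mathlib

open Filter Topology
open scoped Kronecker ComplexOrder

noncomputable section

namespace QChannel

/-- States (density matrices) on the Hilbert space `ℂ^d`. -/
def State (d : Type*) [Fintype d] : Type _ :=
  {ρ : Matrix d d ℂ // ρ.PosSemidef ∧ ρ.trace = 1}

/-- A channel with input set `X` (an arbitrary set) and output space `ℂ^d`. -/
abbrev Channel (X d : Type*) [Fintype d] : Type _ := X → State d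

/-- The matrix of `A 0 ⊗ ⋯ ⊗ A (n-1)` in the product basis of `(ℂ^d)^{⊗ n} = ℂ^(Fin n → d)`. -/
def tensorProd {d : Type*} {n : ℕ} (A : Fin n → Matrix d d ℂ) :
    Matrix (Fin n → d) (Fin n → d) ℂ :=
  Matrix.of fun i j => ∏ k, A k (i k) (j k)

theorem tensorProd_posSemidef {d : Type*} [Fintype d] [DecidableEq d] {n : ℕ}
    (A : Fin n → Matrix d d ℂ) (hA : ∀ k, (A k).PosSemidef) : (tensorProd A).PosSemidef := by
  have h : ∀ k, ∃ B : Matrix d d ℂ, A k = B.conjTranspose * B := fun k => by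
    open scoped MatrixOrder in
    obtain ⟨B, hB⟩ := CStarAlgebra.nonneg_iff_eq_star_mul_self.mp (hA k).nonneg
    exact ⟨B, hB⟩
  choose B hB using h
  have : tensorProd A = (tensorProd B).conjTranspose * tensorProd B := by
    ext i j
    simp only [tensorProd, Matrix.of_apply, Matrix.mul_apply, Matrix.conjTranspose_apply, hB,
      star_prod, ← Finset.prod_mul_distrib]
    rw [← Fintype.piFinset_univ, Finset.sum_prod_piFinset Finset.univ
      (fun k x => star (B k x (i k)) * B k x (j k))]
  rw [this]
  exact Matrix.posSemidef_conjTranspose_mul_self _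

theorem tensorProd_trace {d : Type*} [Fintype d] [DecidableEq d] {n : ℕ}
    (A : Fin n → Matrix d d ℂ) (hA : ∀ k, (A k).trace = 1) : (tensorProd A).trace = 1 := by
  have : (tensorProd A).trace = ∏ k, (A k).trace := by
    simp only [tensorProd, Matrix.trace, Matrix.diag_apply, Matrix.of_apply]
    rw [← Fintype.piFinset_univ, Finset.sum_prod_piFinset Finset.univ (fun k x => A k x x)]
  rw [this]
  simp [hA]

/-- The memoryless extension `W^{⊗ n}(x₁, …, xₙ) = W(x₁) ⊗ ⋯ ⊗ W(xₙ)`. -/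
def Channel.pow {X d : Type*} [Fintype d] [DecidableEq d] (W : Channel X d) (n : ℕ) :
    Channel (Fin n → X) (Fin n → d) := fun x =>
  ⟨tensorProd fun k => (W (x k)).1,
    tensorProd_posSemidef _ fun k => (W (x k)).2.1,
    tensorProd_trace _ fun k => (W (x k)).2.2⟩

/-- The convex combination `∑ᵢ γᵢ Wᵢ` of channels. -/
def Channel.mix {X d : Type*} [Fintype d] {K : ℕ} (γ : Fin K → ℝ) (hγ : ∀ i, 0 < γ i)
    (hsum : ∑ i, γ i = 1) (W : Fin K → Channel X d) : Channel X d := fun x =>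
  ⟨∑ i, (γ i : ℂ) • (W i x).1, by
    refine ⟨Matrix.posSemidef_sum _ fun i _ => ?_, ?_⟩
    · exact (W i x).2.1.smul (by exact_mod_cast (hγ i).le)
    · simp only [Matrix.trace_sum, Matrix.trace_smul, (W _ x).2.2, smul_eq_mul, mul_one]
      exact_mod_cast hsum⟩

/-- A code `(M, φ, Π)` with `M ≥ 1` messages. -/
structure Code (X d : Type*) [Fintype d] [DecidableEq d] where
  size : ℕ
  size_pos : 0 < size
  encode : Fin size → X
  povm : Fin size → Matrix d d ℂ
  povm_posSemidef : ∀ m, (povm m).PosSemidef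
  povm_sum : ∑ m, povm m = 1

/-- The average error probability of a code. -/
def errorProb {X d : Type*} [Fintype d] [DecidableEq d] (C : Code X d) (W : Channel X d) : ℝ :=
  1 / (C.size : ℝ) * ∑ m, (1 - ((W (C.encode m)).1 * C.povm m).trace.re)

/-- The rate `liminf (1/n) log₂ |C⁽ⁿ⁾|` of a sequence of codes. -/
def rate {X d : ℕ → Type*} [∀ n, Fintype (d n)] [∀ n, DecidableEq (d n)]
    (C : ∀ n, Code (X n) (d n)) : EReal :=
  liminf (fun n : ℕ => ((1 / (n : ℝ) * Real.logb 2 (C n).size : ℝ) : EReal)) atTop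

/-- The strong converse capacity of a sequence of channels: the infimum of the real numbers `R`
such that every sequence of codes of rate at least `R` has error probability tending to `1`. -/
def strongConverseCapacity {X d : ℕ → Type*} [∀ n, Fintype (d n)] [∀ n, DecidableEq (d n)]
    (W : ∀ n, Channel (X n) (d n)) : EReal :=
  ⨅ R ∈ {R : ℝ | ∀ C : ∀ n, Code (X n) (d n), (R : EReal) ≤ rate C →
    Tendsto (fun n => errorProb (C n) (W n)) atTop (𝓝 1)}, (R : EReal)

/-- The matrix logarithm to base `2`, with `log 0 = 0`. -/
def matrixLog {n : Type*} [Fintype n] [DecidableEq n] (A : Matrix n n ℂ) : Matrix n n ℂ :=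
  cfc (Real.logb 2) A

/-- The support of a positive semidefinite matrix, i.e. its range. -/
def supp {n : Type*} [Fintype n] (A : Matrix n n ℂ) : Submodule ℂ (n → ℂ) :=
  LinearMap.range A.mulVecLin

open Classical in
/-- The quantum relative entropy `D(ρ‖σ)` of positive semidefinite matrices. -/
def relEntropy {n : Type*} [Fintype n] [DecidableEq n] (ρ σ : Matrix n n ℂ) : EReal :=
  if supp ρ ≤ supp σ then ((ρ * (matrixLog ρ - matrixLog σ)).trace.re : EReal) else ⊤

open Classical in
/-- `ρ_{XB}(p) = ∑ₓ p(x) |x⟩⟨x| ⊗ W(x)`. As `p` is finitely supported, the classical register is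
taken to be spanned by the vectors `|x⟩` with `x` in the (finite) support of `p`. -/
def jointState {X d : Type*} [Fintype d] (W : Channel X d) (p : Convexity.StdSimplex ℝ X) :
    Matrix (p.weights.support × d) (p.weights.support × d) ℂ :=
  ∑ x : p.weights.support, (p.weights x : ℂ) • (Matrix.single x x (1 : ℂ) ⊗ₖ (W x).1)

open Classical in
/-- `ρ_X(p) = ∑ₓ p(x) |x⟩⟨x|`. -/
def inputState {X : Type*} (p : Convexity.StdSimplex ℝ X) :
    Matrix p.weights.support p.weights.support ℂ :=
  ∑ x : p.weights.support, (p.weights x : ℂ) • Matrix.single x x (1 : ℂ)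

open Classical in
/-- `χ(W, p) = inf_σ D(ρ_{XB}(p) ‖ ρ_X(p) ⊗ σ)`, over all states `σ` on the output space. -/
def holevoQuantity {X d : Type*} [Fintype d] [DecidableEq d] (W : Channel X d)
    (p : Convexity.StdSimplex ℝ X) : EReal :=
  ⨅ σ : State d, relEntropy (jointState W p) (inputState p ⊗ₖ σ.1)

/-- The Holevo capacity `χ*(W)`, a supremum over finitely supported input distributions. -/
def holevoCapacity {X d : Type*} [Fintype d] [DecidableEq d] (W : Channel X d) : EReal :=
  ⨆ p : Convexity.StdSimplex ℝ X, holevoQuantity W p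

end QChannel

end

noncomputable section

namespace QChannel

open Matrix Convexity

set_option linter.unusedSectionVars false

/-! ### Diagonalizations -/

/-! The error probability of a code is affine in the channel, so for the averaged channel it is the
`γ`-average of the error probabilities for the `W i`. These are at most 1 and the weights are
positive, so the average tends to 1 exactly when every term does (`tendsto_weighted_sum_iff`). Hence
the strong converse rates of the mixture are the intersection of those of the components
(`mem_strongConverseRates_mix`), and it remains to show that the strong converse capacity of a
memoryless channel is its Holevo capacity. The formula with the supremum over `p` outside then
follows by exchanging two suprema.

The infimum over `σ` in the Holevo quantity is evaluated first: it is the entropy of the average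
output minus the average output entropy (`holevoQuantity_eq`, from Klein's inequality).

Converse: if all mutual informations are at most `c`, then moving a nearly optimal input slightly
towards each `x` produces one full-rank state `σ` whose relative entropy distance from every output
is at most `c + δ` (`exists_posDef_crossEntropy_le`). Chebyshev's inequality for the spectra of
`W^{⊗n}(x)` and `σ^{⊗n}` bounds the success probability of any test on the former by about
`2^{n(c+3δ)}` times that on the latter, uniformly in the codeword. The latter probabilities sum to 1
over the messages, so larger codes fail (`exists_le_errorProb`).

Achievability: codewords are picked greedily with mutually orthogonal decoding projections, which
gives error at most 1/2 at every rate below the mutual information (`exists_codewords`,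
`exists_code`). This already contradicts convergence of the error to 1.

Throughout, explicit diagonalizations turn traces into classical sums over eigenvalues. -/

/-- `A = U diag(a) Uᴴ` with `U` unitary. -/
def Diagonalizes {n : Type*} [Fintype n] [DecidableEq n] (A U : Matrix n n ℂ) (a : n → ℝ) :
    Prop :=
  Uᴴ * U = 1 ∧ A = U * diagonal (fun i => (a i : ℂ)) * Uᴴ

/-- The diagonal of `B` in the basis given by the columns of `U`. -/
def diagWeight {n : Type*} [Fintype n] (U B : Matrix n n ℂ) (i : n) : ℝ := ((Uᴴ * B * U) i i).re

section DiagWeight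

variable {n : Type*} [Fintype n] {B : Matrix n n ℂ}

theorem diagWeight_nonneg (U : Matrix n n ℂ) (hB : B.PosSemidef) (i : n) :
    0 ≤ diagWeight U B i :=
  (Complex.nonneg_iff.mp (hB.conjTranspose_mul_mul_same U).diag_nonneg).1

theorem diagWeight_sub (U B C : Matrix n n ℂ) (i : n) :
    diagWeight U (B - C) i = diagWeight U B i - diagWeight U C i := by
  simp [diagWeight, Matrix.mul_sub, Matrix.sub_mul]

end DiagWeight

section Diag

variable {n : Type*} [Fintype n] [DecidableEq n] {A B U : Matrix n n ℂ} {a : n → ℝ}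

theorem Diagonalizes.mul_conjTranspose (h : Diagonalizes A U a) : U * Uᴴ = 1 :=
  mul_eq_one_comm.mp h.1

theorem exists_diagonalizes (hA : A.IsHermitian) : ∃ U a, Diagonalizes A U a := by
  refine ⟨hA.eigenvectorUnitary, hA.eigenvalues, ?_, ?_⟩
  · exact Unitary.coe_star_mul_self hA.eigenvectorUnitary
  · conv_lhs => rw [hA.spectral_theorem, Unitary.conjStarAlgAut_apply]
    rfl

theorem Diagonalizes.conj_eq (h : Diagonalizes A U a) :
    Uᴴ * A * U = diagonal (fun i => (a i : ℂ)) := by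
  rw [h.2]
  calc _ = (Uᴴ * U) * diagonal (fun i => (a i : ℂ)) * (Uᴴ * U) := by simp only [Matrix.mul_assoc]
    _ = _ := by simp [h.1]

theorem Diagonalizes.diagWeight_self (h : Diagonalizes A U a) (i : n) :
    diagWeight U A i = a i := by
  simp [diagWeight, h.conj_eq]

theorem Diagonalizes.isHermitian (h : Diagonalizes A U a) : A.IsHermitian := by
  rw [h.2]
  refine isHermitian_mul_mul_conjTranspose _ ?_
  refine isHermitian_diagonal_of_self_adjoint _ ?_
  ext i
  simp

theorem Diagonalizes.add {b : n → ℝ} (h : Diagonalizes A U a) (h' : Diagonalizes B U b) :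
    Diagonalizes (A + B) U (fun i => a i + b i) := by
  refine ⟨h.1, ?_⟩
  rw [h.2, h'.2, ← Matrix.add_mul, ← Matrix.mul_add, diagonal_add]
  simp

theorem Diagonalizes.smul (h : Diagonalizes A U a) (c : ℝ) :
    Diagonalizes ((c : ℂ) • A) U (fun i => c * a i) := by
  refine ⟨h.1, ?_⟩
  rw [h.2, ← Matrix.smul_mul, ← Matrix.mul_smul, ← diagonal_smul]
  congr! 3
  ext i
  simp

theorem Diagonalizes.one (h : Diagonalizes A U a) : Diagonalizes (1 : Matrix n n ℂ) U 1 := by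
  refine ⟨h.1, ?_⟩
  simp [h.mul_conjTranspose]

theorem Diagonalizes.posSemidef (h : Diagonalizes A U a) (ha : ∀ i, 0 ≤ a i) :
    A.PosSemidef := by
  rw [h.2]
  refine PosSemidef.mul_mul_conjTranspose_same (PosSemidef.diagonal ?_) U
  intro i
  simpa using ha i

theorem Diagonalizes.nonneg (h : Diagonalizes A U a) (hA : A.PosSemidef) (i : n) : 0 ≤ a i := by
  rw [← h.diagWeight_self]
  exact diagWeight_nonneg U hA i

theorem Diagonalizes.trace_mul (h : Diagonalizes A U a) (B : Matrix n n ℂ) :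
    (B * A).trace.re = ∑ i, a i * diagWeight U B i := by
  have : (B * A).trace = (Uᴴ * B * U * diagonal (fun i => (a i : ℂ))).trace := by
    rw [h.2, ← Matrix.mul_assoc, trace_mul_comm]
    simp only [Matrix.mul_assoc]
  rw [this, trace]
  simp [diagWeight, mul_diagonal, mul_comm]

theorem Diagonalizes.sum_diagWeight (h : Diagonalizes A U a) (B : Matrix n n ℂ) :
    ∑ i, diagWeight U B i = B.trace.re := by
  have := h.one.trace_mul B
  simpa using this.symm

theorem Diagonalizes.trace_re (h : Diagonalizes A U a) : A.trace.re = ∑ i, a i := by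
  rw [← h.sum_diagWeight A]
  simp [h.diagWeight_self]

/-- On a finite set `f` agrees with a Lagrange interpolant, which reduces the claim to polynomials.
Since any diagonalization is allowed, logarithms of tensor products and block matrices can be
computed in product and block eigenbases. -/
theorem Diagonalizes.cfc_eq (h : Diagonalizes A U a) (f : ℝ → ℝ) :
    Diagonalizes (cfc f A) U (fun i => f (a i)) := by
  classical
  refine ⟨h.1, ?_⟩
  obtain ⟨q, hq⟩ : ∃ q : Polynomial ℝ, ∀ x ∈ spectrum ℝ A ∪ Set.range a, q.eval x = f x := by
    have hfin : (spectrum ℝ A ∪ Set.range a).Finite :=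
      (finite_real_spectrum).union (Set.finite_range a)
    refine ⟨Lagrange.interpolate hfin.toFinset id f, fun x hx => ?_⟩
    have := Lagrange.eval_interpolate_at_node (s := hfin.toFinset) (v := id) f
      (Set.injOn_id _) (hfin.mem_toFinset.mpr hx)
    simpa using this
  have hcfc : cfc f A = Polynomial.aeval A q := by
    rw [← cfc_polynomial q A h.isHermitian]
    exact cfc_congr fun x hx => (hq x (Or.inl hx)).symm
  have hf : (fun i => ((f (a i) : ℝ) : ℂ)) = fun i => ((q.eval (a i) : ℝ) : ℂ) := by
    ext i
    rw [hq _ (Or.inr ⟨i, rfl⟩)]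
  rw [hcfc, hf]
  clear hcfc hf hq
  induction q using Polynomial.induction_on with
  | C c =>
    have := (h.one.smul c).2
    simp only [Polynomial.aeval_C, Polynomial.eval_C, Pi.one_apply, mul_one] at this ⊢
    rw [← this]
    ext i j
    simp [algebraMap_matrix_apply, one_apply]
  | add p q hp hq =>
    rw [map_add, hp, hq, ← Matrix.add_mul, ← Matrix.mul_add, diagonal_add]
    simp
  | monomial k c hk =>
    rw [pow_succ, ← mul_assoc, map_mul, hk, Polynomial.aeval_X]
    conv_lhs => enter [2]; rw [h.2]
    calc _ = U * (diagonal (fun i => ((Polynomial.eval (a i) (Polynomial.C c * Polynomial.X ^ k) :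
        ℝ) : ℂ)) * (Uᴴ * U) * diagonal (fun i => (a i : ℂ))) * Uᴴ := by
          simp only [Matrix.mul_assoc]
      _ = _ := by
          rw [h.1, Matrix.mul_one, diagonal_mul_diagonal]
          simp

theorem Diagonalizes.matrixLog (h : Diagonalizes A U a) :
    Diagonalizes (matrixLog A) U (fun i => Real.logb 2 (a i)) := h.cfc_eq _

end Diag

/-! ### Monotonicity of the trace pairing -/

section TraceOrder

variable {n : Type*} [Fintype n]

theorem trace_mul_nonneg {A B : Matrix n n ℂ} (hA : A.PosSemidef) (hB : B.PosSemidef) :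
    0 ≤ (A * B).trace.re := by
  classical
  obtain ⟨U, b, h⟩ := exists_diagonalizes hB.isHermitian
  rw [h.trace_mul]
  exact Finset.sum_nonneg fun i _ => mul_nonneg (h.nonneg hB i) (diagWeight_nonneg U hA i)

theorem trace_mul_le_trace_mul {A B C : Matrix n n ℂ} (hAB : (B - A).PosSemidef)
    (hC : C.PosSemidef) : (A * C).trace.re ≤ (B * C).trace.re := by
  have := trace_mul_nonneg hAB hC
  simp only [Matrix.sub_mul, trace_sub, Complex.sub_re] at this
  linarith

theorem trace_mul_le_trace [DecidableEq n] {A C : Matrix n n ℂ} (hA : A.PosSemidef)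
    (hC : (1 - C).PosSemidef) : (A * C).trace.re ≤ A.trace.re := by
  have := trace_mul_nonneg hA hC
  simp only [Matrix.mul_sub, Matrix.mul_one, trace_sub, Complex.sub_re] at this
  linarith

end TraceOrder

/-! ### Tensor products -/

section Tensor

variable {d : Type*} {n : ℕ}

theorem tensorProd_conjTranspose (A : Fin n → Matrix d d ℂ) :
    (tensorProd A)ᴴ = tensorProd fun k => (A k)ᴴ := by
  ext i j
  simp [tensorProd]

theorem sum_prod_smul_tensorProd {ι : Type*} [Fintype ι] (w : ι → ℝ)
    (A : ι → Matrix d d ℂ) :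
    ∑ x : Fin n → ι, ((∏ k, w (x k) : ℝ) : ℂ) • tensorProd (fun k => A (x k)) =
      tensorProd fun _ => ∑ y, (w y : ℂ) • A y := by
  ext i j
  simp only [Matrix.sum_apply, Matrix.smul_apply, tensorProd, of_apply, smul_eq_mul, Complex.ofReal_prod,
    ← Finset.prod_mul_distrib]
  rw [← Fintype.piFinset_univ, Finset.sum_prod_piFinset Finset.univ
      (fun k y => (w y : ℂ) * A y (i k) (j k))]

theorem tensorProd_mul [Fintype d] (A B : Fin n → Matrix d d ℂ) :
    tensorProd A * tensorProd B = tensorProd fun k => A k * B k := by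
  ext i j
  simp only [tensorProd, of_apply, mul_apply, ← Finset.prod_mul_distrib]
  rw [← Fintype.piFinset_univ, Finset.sum_prod_piFinset Finset.univ
      (fun k x => A k (i k) x * B k x (j k))]

/-- Hermiticity makes each factor's diagonal entries real; otherwise real parts would not multiply.
-/
theorem diagWeight_tensorProd [Fintype d] {A U : Fin n → Matrix d d ℂ} (hA : ∀ k, (A k).IsHermitian)
    (i : Fin n → d) :
    diagWeight (tensorProd U) (tensorProd A) i = ∏ k, diagWeight (U k) (A k) (i k) := by
  have h : ∀ k j, ((diagWeight (U k) (A k) j : ℝ) : ℂ) = ((U k)ᴴ * A k * U k) j j := fun k j =>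
    Complex.conj_eq_iff_re.mp
      ((isHermitian_conjTranspose_mul_mul (U k) (hA k)).apply j j)
  rw [diagWeight, tensorProd_conjTranspose, tensorProd_mul, tensorProd_mul, QChannel.tensorProd,
    of_apply]
  simp only [← h]
  rw [← Complex.ofReal_prod, Complex.ofReal_re]

variable [DecidableEq d]

theorem tensorProd_diagonal (a : Fin n → d → ℂ) :
    tensorProd (fun k => diagonal (a k)) = diagonal fun i => ∏ k, a k (i k) := by
  ext i j
  simp only [tensorProd, of_apply, diagonal_apply]
  split_ifs with h
  · subst h
    simp
  · obtain ⟨k, hk⟩ := Function.ne_iff.mp h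
    exact Finset.prod_eq_zero (Finset.mem_univ k) (if_neg hk)

theorem tensorProd_one : tensorProd (fun _ : Fin n => (1 : Matrix d d ℂ)) = 1 := by
  have := tensorProd_diagonal (fun (_ : Fin n) (_ : d) => (1 : ℂ))
  simpa using this

variable [Fintype d]

theorem Diagonalizes.tensorProd {A U : Fin n → Matrix d d ℂ} {a : Fin n → d → ℝ}
    (h : ∀ k, Diagonalizes (A k) (U k) (a k)) :
    Diagonalizes (tensorProd A) (tensorProd U) fun i => ∏ k, a k (i k) := by
  refine ⟨?_, ?_⟩
  · rw [tensorProd_conjTranspose, tensorProd_mul]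
    simp only [(h _).1, tensorProd_one]
  · push_cast
    rw [← tensorProd_diagonal (fun k i => (a k i : ℂ)), tensorProd_conjTranspose, tensorProd_mul,
      tensorProd_mul]
    congr 1
    funext k
    exact (h k).2

end Tensor

/-! ### Chebyshev's inequality for finite product distributions -/

section Chebyshev

/-- Mass, mean and variance of a sum of independent centred variables. The three are proved in one
induction, because splitting off a coordinate in the second moment leaves cross terms that vanish by
the first two. -/
theorem sum_prod_mul_sq {ι : Type*} [Fintype ι] {n : ℕ} (w g : Fin n → ι → ℝ)
    (hw : ∀ k, ∑ i, w k i = 1) (hg : ∀ k, ∑ i, w k i * g k i = 0) :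
    (∑ i : Fin n → ι, ∏ k, w k (i k) = 1) ∧
    (∑ i : Fin n → ι, (∏ k, w k (i k)) * ∑ k, g k (i k) = 0) ∧
    (∑ i : Fin n → ι, (∏ k, w k (i k)) * (∑ k, g k (i k)) ^ 2 = ∑ k, ∑ i, w k i * g k i ^ 2) := by
  induction n with
  | zero => simp
  | succ n ih =>
    obtain ⟨h1, h2, h3⟩ := ih (fun k => w k.succ) (fun k => g k.succ) (fun k => hw _)
      (fun k => hg _)
    have key : ∀ F : (Fin (n + 1) → ι) → ℝ,
        ∑ i, F i = ∑ x : ι, ∑ i : Fin n → ι, F (Fin.cons x i) := fun F => by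
      rw [← (Fin.consEquiv fun _ => ι).sum_comp, Fintype.sum_prod_type]
      rfl
    refine ⟨?_, ?_, ?_⟩
    · rw [key]
      simp only [Fin.prod_univ_succ, Fin.cons_zero, Fin.cons_succ, ← Finset.mul_sum, h1, mul_one,
        hw]
    · rw [key]
      simp only [Fin.prod_univ_succ, Fin.sum_univ_succ, Fin.cons_zero, Fin.cons_succ]
      have : ∀ (x : ι) (i : Fin n → ι), w 0 x * (∏ k, w k.succ (i k)) *
          (g 0 x + ∑ k, g k.succ (i k)) = w 0 x * g 0 x * (∏ k, w k.succ (i k)) +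
            w 0 x * ((∏ k, w k.succ (i k)) * ∑ k, g k.succ (i k)) := fun x i => by ring
      simp only [this, Finset.sum_add_distrib, ← Finset.mul_sum, h1, h2, mul_one, mul_zero, hg,
        add_zero]
    · rw [key, Fin.sum_univ_succ (fun k => ∑ i, w k i * g k i ^ 2)]
      simp only [Fin.prod_univ_succ, Fin.sum_univ_succ, Fin.cons_zero, Fin.cons_succ]
      have : ∀ (x : ι) (i : Fin n → ι), w 0 x * (∏ k, w k.succ (i k)) *
          (g 0 x + ∑ k, g k.succ (i k)) ^ 2 = w 0 x * g 0 x ^ 2 * (∏ k, w k.succ (i k)) +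
            2 * (w 0 x * g 0 x) * ((∏ k, w k.succ (i k)) * ∑ k, g k.succ (i k)) +
            w 0 x * ((∏ k, w k.succ (i k)) * (∑ k, g k.succ (i k)) ^ 2) := fun x i => by ring
      simp only [this, Finset.sum_add_distrib, ← Finset.mul_sum, h1, h2, h3, mul_one, mul_zero,
        add_zero, ← Finset.sum_mul, hw, one_mul]

/-- Chebyshev's inequality for a sum of independent random variables with finitely many values. -/
theorem sum_prod_le_of_deviation {ι : Type*} [Fintype ι] {n : ℕ} (hn : 0 < n)
    (w f : Fin n → ι → ℝ) (hw0 : ∀ k i, 0 ≤ w k i) (hw : ∀ k, ∑ i, w k i = 1) {C δ : ℝ}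
    (hC : ∀ k, ∑ i, w k i * f k i ^ 2 ≤ C) (hδ : 0 < δ) (s : Finset (Fin n → ι))
    (hs : ∀ i ∈ s, (∀ k, 0 < w k (i k)) →
      n * δ ≤ |∑ k, f k (i k) - ∑ k, ∑ j, w k j * f k j|) :
    ∑ i ∈ s, ∏ k, w k (i k) ≤ C / (n * δ ^ 2) := by
  set m : Fin n → ℝ := fun k => ∑ j, w k j * f k j with hm
  obtain ⟨-, -, h3⟩ := sum_prod_mul_sq w (fun k i => f k i - m k) hw (fun k => by
    simp only [mul_sub, Finset.sum_sub_distrib, ← Finset.sum_mul, hw, one_mul]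
    simp [hm])
  have hvar : ∀ k, ∑ i, w k i * (f k i - m k) ^ 2 ≤ C := fun k => by
    have : ∀ i, w k i * (f k i - m k) ^ 2 =
        w k i * f k i ^ 2 - 2 * m k * (w k i * f k i) + w k i * m k ^ 2 := fun i => by ring
    simp only [this, Finset.sum_add_distrib, Finset.sum_sub_distrib, ← Finset.mul_sum,
      ← Finset.sum_mul, hw]
    have := hC k
    have hmk : ∑ i, w k i * f k i = m k := rfl
    rw [hmk]
    nlinarith [sq_nonneg (m k)]
  have hnpos : (0 : ℝ) < n := by exact_mod_cast hn
  have hP (i : Fin n → ι) : 0 ≤ ∏ k, w k (i k) :=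
    Finset.prod_nonneg fun k _ => hw0 k (i k)
  have h4 : (n * δ) ^ 2 * ∑ i ∈ s, ∏ k, w k (i k) ≤ n * C := by
    calc (n * δ) ^ 2 * ∑ i ∈ s, ∏ k, w k (i k)
        = ∑ i ∈ s, (∏ k, w k (i k)) * (n * δ) ^ 2 := by
          rw [mul_comm, Finset.sum_mul]
      _ ≤ ∑ i ∈ s, (∏ k, w k (i k)) * (∑ k, (f k (i k) - m k)) ^ 2 := by
          refine Finset.sum_le_sum fun i hi => ?_
          -- Points with a vanishing weight contribute nothing, so no deviation is required there.
          -- This excludes zero eigenvalues, whose logarithm is only a default value, when `f` is a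
          -- log of the weights.
          by_cases hz : ∀ k, 0 < w k (i k)
          · refine mul_le_mul_of_nonneg_left ?_ (hP i)
            rw [← sq_abs (∑ k, (f k (i k) - m k)), Finset.sum_sub_distrib]
            exact pow_le_pow_left₀ (by positivity) (hs i hi hz) 2
          · push Not at hz
            obtain ⟨k, hk⟩ := hz
            have : ∏ k, w k (i k) = 0 :=
              Finset.prod_eq_zero (Finset.mem_univ k) (le_antisymm hk (hw0 _ _))
            simp [this]
      _ ≤ ∑ i : Fin n → ι, (∏ k, w k (i k)) * (∑ k, (f k (i k) - m k)) ^ 2 :=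
          Finset.sum_le_sum_of_subset_of_nonneg (Finset.subset_univ s)
            fun i _ _ => mul_nonneg (hP i) (sq_nonneg _)
      _ ≤ ∑ _k : Fin n, C := by
          rw [h3]
          exact Finset.sum_le_sum fun k _ => hvar k
      _ = n * C := by simp
  rw [le_div_iff₀ (by positivity)]
  have h5 : (n : ℝ) * (n * δ ^ 2 * ∑ i ∈ s, ∏ k, w k (i k)) ≤ n * C := by
    calc _ = (n * δ) ^ 2 * ∑ i ∈ s, ∏ k, w k (i k) := by ring
      _ ≤ _ := h4
  have := le_of_mul_le_mul_left h5 hnpos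
  linarith

/-- The square of `|√x log x| < 2`. It bounds the variance of `-log` of the eigenvalues by a
constant depending on the dimension alone, hence uniformly over the possibly infinite input set. -/
theorem mul_logb_sq_le {x : ℝ} (h0 : 0 ≤ x) (h1 : x ≤ 1) :
    x * Real.logb 2 x ^ 2 ≤ 4 / Real.log 2 ^ 2 := by
  have hl : 0 < Real.log 2 := Real.log_pos (by norm_num)
  rcases h0.eq_or_lt with rfl | hx
  · simp only [zero_mul]
    positivity
  · have h := Real.abs_log_mul_self_rpow_lt x (1 / 2) hx h1 (by norm_num)
    have h2 : x * Real.log x ^ 2 ≤ 4 := by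
      have hs : (Real.log x * x ^ (1 / 2 : ℝ)) ^ 2 = x * Real.log x ^ 2 := by
        rw [mul_pow, ← Real.rpow_natCast (x ^ (1 / 2 : ℝ)), ← Real.rpow_mul hx.le]
        norm_num
        ring
      rw [← hs, ← sq_abs]
      have := abs_nonneg (Real.log x * x ^ (1 / 2 : ℝ))
      have h' : |Real.log x * x ^ (1 / 2 : ℝ)| < 2 := by linarith
      nlinarith
    rw [Real.logb, div_pow, ← mul_div_assoc]
    exact div_le_div_of_nonneg_right h2 (by positivity)

end Chebyshev

/-! ### The strong converse bound -/

section OneShot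

variable {n : Type*} [Fintype n] [DecidableEq n] {A B U V Q : Matrix n n ℂ} {a b : n → ℝ}

theorem Diagonalizes.congr (h : Diagonalizes A U a) (hab : ∀ i, a i = b i) :
    Diagonalizes A U b := by
  rwa [← funext hab]

/-- Reduces identities between operators diagonal in a common basis to identities between
eigenvalues. -/
theorem Diagonalizes.unique (h : Diagonalizes A U a) (h' : Diagonalizes B U a) : A = B := by
  rw [h.2, h'.2]

/-- The function `f` of the index of the eigenbasis `U`, as a matrix. -/
def spectralFun (U : Matrix n n ℂ) (f : n → ℝ) : Matrix n n ℂ :=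
  U * diagonal (fun i => (f i : ℂ)) * Uᴴ

theorem Diagonalizes.spectralFun (h : Diagonalizes A U a) (f : n → ℝ) :
    Diagonalizes (spectralFun U f) U f := ⟨h.1, rfl⟩

theorem Diagonalizes.mul (h : Diagonalizes A U a) (h' : Diagonalizes B U b) :
    Diagonalizes (A * B) U (fun i => a i * b i) := by
  refine ⟨h.1, ?_⟩
  calc A * B = U * (diagonal (fun i => (a i : ℂ)) * (Uᴴ * U) * diagonal (fun i => (b i : ℂ))) * Uᴴ
        := by
        rw [h.2, h'.2]
        simp only [Matrix.mul_assoc]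
    _ = _ := by
        rw [h.1, Matrix.mul_one, diagonal_mul_diagonal]
        simp

theorem Diagonalizes.sub (h : Diagonalizes A U a) (h' : Diagonalizes B U b) :
    Diagonalizes (A - B) U (fun i => a i - b i) := by
  have := h.add (h'.smul (-1))
  refine ⟨h.1, ?_⟩
  have h2 := this.2
  simp only [Complex.ofReal_neg, Complex.ofReal_one, neg_smul, one_smul, neg_mul, one_mul] at h2
  rw [sub_eq_add_neg, h2]
  simp [sub_eq_add_neg]

/-- One-shot converse: the success probability of a test on `A`, up to the spectral tails of `A`
and of `B`, is bounded by its success probability on `B`. -/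
theorem trace_mul_le_spectral_tails (hA : Diagonalizes A U a) (ha : ∀ i, 0 ≤ a i)
    (hB : Diagonalizes B V b) (hb : ∀ i, 0 ≤ b i) (hQ : Q.PosSemidef) (hQ1 : (1 - Q).PosSemidef)
    {α β : ℝ} (hα : 0 ≤ α) (hβ : 0 < β) :
    (A * Q).trace.re ≤ ∑ i with α < a i, a i + 2 * ∑ j with b j < β, diagWeight V A j +
      2 * (α / β) * (B * Q).trace.re := by
  -- `At ≤ α` is `A` without its large eigenvalues and `Aa` is the removed part. `T` projects onto
  -- the eigenvalues of `B` that are at least `β`, so `β T ≤ B`, and `R = 1 - T`.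
  have hAt := hA.spectralFun fun i => if α < a i then 0 else a i
  have hAa := hA.spectralFun fun i => if α < a i then a i else 0
  set At := spectralFun U fun i => if α < a i then 0 else a i
  set Aa := spectralFun U fun i => if α < a i then a i else 0
  have hT := hB.spectralFun fun j => if b j < β then 0 else 1
  have hR := hB.spectralFun fun j => if b j < β then 1 else 0
  set T := spectralFun V fun j => if b j < β then 0 else 1
  set R := spectralFun V fun j => if b j < β then 1 else 0
  have hAtpos : At.PosSemidef := hAt.posSemidef fun i => by split_ifs <;> simp [ha]
  have hAapos : Aa.PosSemidef := hAa.posSemidef fun i => by split_ifs <;> simp [ha]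
  have hTH : Tᴴ = T := hT.isHermitian
  have hRH : Rᴴ = R := hR.isHermitian
  have hsplit : A = At + Aa := hA.unique ((hAt.add hAa).congr fun i => by split_ifs <;> simp)
  have hTR : T + R = 1 := (hT.add hR).unique (hB.one.congr fun i => by
    simp only [Pi.one_apply]
    split_ifs <;> simp)
  have hTT : T * T = T := (hT.mul hT).unique (hT.congr fun i => by split_ifs <;> simp)
  have hRR : R * R = R := (hR.mul hR).unique (hR.congr fun i => by split_ifs <;> simp)
  -- Pinching: `(T - R) At (T - R) ≥ 0` bounds the off-diagonal blocks by the diagonal ones, so `At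
  -- ≤ 2 (T At T + R At R)`. This is the source of the factors 2.
  have hpinch : ((T * At * T + T * At * T + (R * At * R + R * At * R)) - At).PosSemidef := by
    have h := hAtpos.mul_mul_conjTranspose_same (T - R)
    rw [conjTranspose_sub, hTH, hRH] at h
    convert h using 1
    have : At = (T + R) * At * (T + R) := by simp [hTR]
    nth_rw 5 [this]
    noncomm_ring
  have h1 := trace_mul_le_trace_mul hpinch hQ
  have hRAR : (R * At * R).PosSemidef := by
    have h := hAtpos.mul_mul_conjTranspose_same R
    rwa [hRH] at h
  have h2 := trace_mul_le_trace hRAR hQ1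
  have h3 : (R * At * R).trace.re ≤ ∑ j with b j < β, diagWeight V A j := by
    have e : (R * At * R).trace = (At * R).trace := by
      rw [Matrix.mul_assoc, trace_mul_comm, Matrix.mul_assoc, hRR]
    have hle : (At * R).trace.re ≤ (A * R).trace.re :=
      trace_mul_le_trace_mul (by rw [hsplit]; simpa using hAapos)
        (hR.posSemidef fun i => by split_ifs <;> simp)
    rw [e]
    refine hle.trans (le_of_eq ?_)
    rw [hR.trace_mul, Finset.sum_filter]
    exact Finset.sum_congr rfl fun j _ => by split_ifs <;> simp
  have h4 : (T * At * T * Q).trace.re ≤ α * (T * Q).trace.re := by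
    have hle : ((α : ℂ) • (1 : Matrix n n ℂ) - At).PosSemidef :=
      ((hA.one.smul α).sub hAt).posSemidef fun i => by
        simp only [Pi.one_apply]
        split_ifs with h
        · simpa using hα
        · simpa using not_lt.mp h
    have h := hle.mul_mul_conjTranspose_same T
    rw [hTH, Matrix.mul_sub, Matrix.sub_mul] at h
    have e : T * ((α : ℂ) • (1 : Matrix n n ℂ)) * T = (α : ℂ) • T := by simp [hTT]
    rw [e] at h
    have := trace_mul_le_trace_mul h hQ
    simpa using this
  have h5 : β * (T * Q).trace.re ≤ (B * Q).trace.re := by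
    have hle : (B - (β : ℂ) • T).PosSemidef := (hB.sub (hT.smul β)).posSemidef fun i => by
      split_ifs with h
      · simpa using hb i
      · simpa using not_lt.mp h
    have := trace_mul_le_trace_mul hle hQ
    simpa using this
  have h6 : (Aa * Q).trace.re ≤ ∑ i with α < a i, a i := by
    refine (trace_mul_le_trace hAapos hQ1).trans (le_of_eq ?_)
    rw [hAa.trace_re, Finset.sum_filter]
  have h7 : (A * Q).trace.re = (At * Q).trace.re + (Aa * Q).trace.re := by
    rw [hsplit, Matrix.add_mul, trace_add, Complex.add_re]
  have h8 : α * (T * Q).trace.re ≤ α / β * (B * Q).trace.re := by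
    rw [div_mul_eq_mul_div, le_div_iff₀ hβ, mul_assoc, mul_comm _ β]
    exact mul_le_mul_of_nonneg_left h5 hα
  simp only [Matrix.add_mul, trace_add, Complex.add_re] at h1
  linarith

end OneShot

/-- The cross entropy `-Tr ρ log σ`. -/
def crossEntropy {n : Type*} [Fintype n] [DecidableEq n] (ρ σ : Matrix n n ℂ) : ℝ :=
  -(ρ * matrixLog σ).trace.re

theorem Diagonalizes.crossEntropy_eq {n : Type*} [Fintype n] [DecidableEq n]
    {B V : Matrix n n ℂ} {b : n → ℝ} (h : Diagonalizes B V b) (A : Matrix n n ℂ) :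
    crossEntropy A B = ∑ j, diagWeight V A j * -Real.logb 2 (b j) := by
  rw [crossEntropy, h.matrixLog.trace_mul, ← Finset.sum_neg_distrib]
  exact Finset.sum_congr rfl fun j _ => by ring

theorem sum_mul_logb_sq_le {d : Type*} [Fintype d] {a : d → ℝ} (h0 : ∀ i, 0 ≤ a i) (h1 : ∀ i, a i ≤ 1) :
    ∑ i, a i * (-Real.logb 2 (a i)) ^ 2 ≤ Fintype.card d * (4 / Real.log 2 ^ 2) := by
  calc _ ≤ ∑ _i : d, 4 / Real.log 2 ^ 2 :=
        Finset.sum_le_sum fun i _ => by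
          rw [neg_sq]
          exact mul_logb_sq_le (h0 i) (h1 i)
    _ = _ := by simp

theorem prod_eq_two_rpow {n : ℕ} {x : Fin n → ℝ} (hx : ∀ k, 0 < x k) :
    ∏ k, x k = 2 ^ (-∑ k, -Real.logb 2 (x k)) := by
  rw [Finset.sum_neg_distrib, neg_neg, Real.rpow_sum_of_pos (by norm_num)]
  exact Finset.prod_congr rfl fun k _ => (Real.rpow_logb (by norm_num) (by norm_num) (hx k)).symm

/-! ### Strong converse bounds for product states and codes -/

section States

variable {d : Type*} [Fintype d] [DecidableEq d]

theorem State.exists_diagonalizes (ρ : State d) :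
    ∃ U a, Diagonalizes ρ.1 U a ∧ (∀ i, 0 ≤ a i) ∧ ∑ i, a i = 1 ∧ ∀ i, a i ≤ 1 := by
  obtain ⟨U, a, h⟩ := QChannel.exists_diagonalizes ρ.2.1.isHermitian
  have h0 := h.nonneg ρ.2.1
  have h1 : ∑ i, a i = 1 := by rw [← h.trace_re, ρ.2.2, Complex.one_re]
  exact ⟨U, a, h, h0, h1, fun i => h1 ▸ Finset.single_le_sum (fun j _ => h0 j) (Finset.mem_univ i)⟩

/-- Strong converse bound for one message: uniformly over the codewords, the success probability
of a test on `W(x₁) ⊗ ⋯ ⊗ W(xₙ)` is controlled by its success probability on `σ^{⊗ n}`. -/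
theorem exists_trace_pow_mul_le {X : Type*} (W : Channel X d) (σ : State d)
    (hσ : σ.1.PosDef) {c : ℝ}
    (hc : ∀ x, crossEntropy (W x).1 σ.1 - crossEntropy (W x).1 (W x).1 ≤ c) {δ : ℝ} (hδ : 0 < δ) :
    ∃ C : ℝ, ∀ n : ℕ, 0 < n → ∀ (x : Fin n → X) (Q : Matrix (Fin n → d) (Fin n → d) ℂ),
      Q.PosSemidef → (1 - Q).PosSemidef →
      ((W.pow n x).1 * Q).trace.re ≤
        C / n + 2 * 2 ^ (n * (c + 2 * δ)) * (tensorProd (fun _ : Fin n => σ.1) * Q).trace.re := by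
  choose U a hU ha0 ha1 hale using fun x => (W x).exists_diagonalizes
  obtain ⟨V, b, hV, hb0, hb1, hble⟩ := σ.exists_diagonalizes
  -- In the tail of `σ^{⊗n}` the weights come from `W (x k)`, so their positivity says nothing about
  -- `b`; full rank of `σ` supplies it.
  have hbpos : ∀ j, 0 < b j := fun j => by
    rw [← hV.diagWeight_self]
    have hinj : Function.Injective V.mulVec :=
      mulVec_injective_of_isUnit ((isUnit_iff_isUnit_det _).mpr
        (isUnit_det_of_left_inverse hV.1))
    exact (Complex.pos_iff.mp ((hσ.conjTranspose_mul_mul_same hinj).diag_pos (i := j))).1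
  set L : ℝ := Fintype.card d * (4 / Real.log 2 ^ 2)
  set L' : ℝ := ∑ j, (-Real.logb 2 (b j)) ^ 2
  refine ⟨L / δ ^ 2 + 2 * (L' / δ ^ 2), fun n hn x Q hQ hQ1 => ?_⟩
  have hn' : (0 : ℝ) < n := by exact_mod_cast hn
  have hA : Diagonalizes (W.pow n x).1 (tensorProd fun k => U (x k))
      fun i => ∏ k, a (x k) (i k) := Diagonalizes.tensorProd fun k => hU (x k)
  have hB : Diagonalizes (tensorProd fun _ : Fin n => σ.1) (tensorProd fun _ => V)
      fun i => ∏ k, b (i k) := Diagonalizes.tensorProd fun _ => hV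
  set HW : ℝ := ∑ k, crossEntropy (W (x k)).1 (W (x k)).1
  set HS : ℝ := ∑ k, crossEntropy (W (x k)).1 σ.1
  -- Under the law of the eigenvalues of `W^{⊗n}(x)`, resp. its diagonal in the basis of `σ^{⊗n}`,
  -- the exponents of the eigenvalues concentrate at `HW`, resp. `HS`. Each threshold leaves a
  -- margin `n δ`, so both tails are Chebyshev events and `α / β ≤ 2^{n(c+2δ)}`.
  have key := trace_mul_le_spectral_tails hA (fun i => Finset.prod_nonneg fun k _ => ha0 _ _) hB
    (fun i => Finset.prod_nonneg fun k _ => hb0 _) hQ hQ1 (α := 2 ^ (-(HW - n * δ)))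
    (β := 2 ^ (-(HS + n * δ))) (by positivity) (by positivity)
  have t1 : ∑ i : Fin n → d with (2 : ℝ) ^ (-(HW - n * δ)) < ∏ k, a (x k) (i k), ∏ k, a (x k) (i k) ≤
      L / (n * δ ^ 2) := by
    refine sum_prod_le_of_deviation hn (fun k => a (x k)) (fun k i => -Real.logb 2 (a (x k) i))
      (fun k => ha0 _) (fun k => ha1 _) (fun k => sum_mul_logb_sq_le (ha0 _) (hale _)) hδ _ ?_
    intro i hi hpos
    rw [Finset.mem_filter, prod_eq_two_rpow hpos] at hi
    have h := (Real.rpow_lt_rpow_left_iff (by norm_num)).mp hi.2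
    have e : ∑ k, ∑ j, a (x k) j * -Real.logb 2 (a (x k) j) = HW :=
      Finset.sum_congr rfl fun k _ => by
        simp only [(hU (x k)).crossEntropy_eq, (hU (x k)).diagWeight_self]
    rw [e, le_abs]
    right
    linarith
  have t2 : ∑ j : Fin n → d with ∏ k, b (j k) < (2 : ℝ) ^ (-(HS + n * δ)),
      diagWeight (tensorProd fun _ => V) (W.pow n x).1 j ≤ L' / (n * δ ^ 2) := by
    have e : ∀ j, diagWeight (tensorProd fun _ => V) (W.pow n x).1 j =
        ∏ k, diagWeight V (W (x k)).1 (j k) := fun j =>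
      diagWeight_tensorProd (fun k => (W (x k)).2.1.isHermitian) j
    simp only [e]
    have hw0 : ∀ (k : Fin n) j, 0 ≤ diagWeight V (W (x k)).1 j := fun k j =>
      diagWeight_nonneg V (W (x k)).2.1 j
    have hw1 : ∀ k : Fin n, ∑ j, diagWeight V (W (x k)).1 j = 1 := fun k => by
      rw [hV.sum_diagWeight, (W (x k)).2.2, Complex.one_re]
    refine sum_prod_le_of_deviation hn _ (fun k j => -Real.logb 2 (b j)) hw0 hw1 (fun k => ?_) hδ
      _ ?_
    · refine Finset.sum_le_sum fun j _ => ?_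
      have : diagWeight V (W (x k)).1 j ≤ 1 :=
        hw1 k ▸ Finset.single_le_sum (fun j _ => hw0 k j) (Finset.mem_univ j)
      exact mul_le_of_le_one_left (sq_nonneg _) this
    · intro i hi _
      rw [Finset.mem_filter, prod_eq_two_rpow fun k => hbpos (i k)] at hi
      have h := (Real.rpow_lt_rpow_left_iff (by norm_num)).mp hi.2
      have e : ∑ k, ∑ j, diagWeight V (W (x k)).1 j * -Real.logb 2 (b j) = HS :=
        Finset.sum_congr rfl fun k _ => (hV.crossEntropy_eq _).symm
      rw [e, le_abs]
      left
      linarith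
  have t3 : (2 : ℝ) ^ (-(HW - n * δ)) / 2 ^ (-(HS + n * δ)) ≤ 2 ^ (n * (c + 2 * δ)) := by
    rw [← Real.rpow_sub (by norm_num)]
    refine Real.rpow_le_rpow_of_exponent_le (by norm_num) ?_
    have : HS - HW ≤ n * c := by
      calc HS - HW = ∑ k, (crossEntropy (W (x k)).1 σ.1 - crossEntropy (W (x k)).1 (W (x k)).1) :=
            (Finset.sum_sub_distrib _ _).symm
        _ ≤ ∑ _k : Fin n, c := Finset.sum_le_sum fun k _ => hc (x k)
        _ = n * c := by simp
    linarith
  have t4 : 0 ≤ (tensorProd (fun _ : Fin n => σ.1) * Q).trace.re :=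
    trace_mul_nonneg (tensorProd_posSemidef _ fun _ => σ.2.1) hQ
  have t5 := mul_le_mul_of_nonneg_right (mul_le_mul_of_nonneg_left t3 zero_le_two) t4
  have e : (L / δ ^ 2 + 2 * (L' / δ ^ 2)) / n = L / (n * δ ^ 2) + 2 * (L' / (n * δ ^ 2)) := by
    field_simp
  rw [e]
  linarith

/-- Strong converse bound for codes. -/
theorem exists_le_errorProb {X : Type*} (W : Channel X d) (σ : State d)
    (hσ : σ.1.PosDef) {c : ℝ}
    (hc : ∀ x, crossEntropy (W x).1 σ.1 - crossEntropy (W x).1 (W x).1 ≤ c) {δ : ℝ} (hδ : 0 < δ) :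
    ∃ C : ℝ, ∀ n : ℕ, 0 < n → ∀ K : Code (Fin n → X) (Fin n → d),
      1 - (C / n + 2 * 2 ^ (n * (c + 2 * δ)) / K.size) ≤ errorProb K (W.pow n) := by
  obtain ⟨C, hC⟩ := exists_trace_pow_mul_le W σ hσ hc hδ
  refine ⟨C, fun n hn K => ?_⟩
  have hM : (0 : ℝ) < K.size := by exact_mod_cast K.size_pos
  have hQ1 : ∀ m, (1 - K.povm m).PosSemidef := fun m => by
    rw [← K.povm_sum, ← Finset.sum_erase_eq_sub (Finset.mem_univ m)]
    exact posSemidef_sum _ fun i _ => K.povm_posSemidef i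
  set S := tensorProd (fun _ : Fin n => σ.1)
  -- On the fixed state `S` the decoder can do no better than guess: the success probability
  -- averages to `1 / K.size`.
  have hS : ∑ m, (S * K.povm m).trace.re = 1 := by
    rw [← Complex.re_sum, ← trace_sum, ← Finset.mul_sum, K.povm_sum, Matrix.mul_one,
      tensorProd_trace _ fun _ => σ.2.2, Complex.one_re]
  have hsum : ∑ m, ((W.pow n (K.encode m)).1 * K.povm m).trace.re ≤
      K.size * (C / n) + 2 * 2 ^ (n * (c + 2 * δ)) := by
    calc _ ≤ ∑ m, (C / n + 2 * 2 ^ (n * (c + 2 * δ)) * (S * K.povm m).trace.re) :=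
          Finset.sum_le_sum fun m _ => hC n hn _ _ (K.povm_posSemidef m) (hQ1 m)
      _ = _ := by
          rw [Finset.sum_add_distrib, ← Finset.mul_sum, hS]
          simp
  rw [errorProb, Finset.sum_sub_distrib]
  simp only [Finset.sum_const, Finset.card_univ, Fintype.card_fin, nsmul_eq_mul, mul_one]
  rw [one_div_mul_eq_div, le_div_iff₀ hM, sub_mul, add_mul, div_mul_cancel₀ _ hM.ne']
  linarith

end States

/-! ### Properties of the cross entropy -/

section CrossEntropy

variable {n : Type*} [Fintype n] [DecidableEq n] {A B U V : Matrix n n ℂ} {a b : n → ℝ}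

/-- Makes the convention `log 0 = 0` harmless: zero eigenvalues of `B` carry no weight of `A`. -/
theorem Diagonalizes.diagWeight_eq_zero (h : Diagonalizes B V b)
    (hker : ∀ v, B *ᵥ v = 0 → A *ᵥ v = 0) {j : n} (hj : b j = 0) : diagWeight V A j = 0 := by
  have hBV : B * V = V * diagonal (fun i => (b i : ℂ)) := by
    rw [h.2, Matrix.mul_assoc, h.1, Matrix.mul_one]
  have hB : B *ᵥ (fun k => V k j) = 0 := by
    ext i
    have : (B *ᵥ fun k => V k j) i = (B * V) i j := rfl
    rw [this, hBV, mul_diagonal, hj]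
    simp
  have hA : ∀ i, (A * V) i j = 0 := fun i => congrFun (hker _ hB) i
  rw [diagWeight, Matrix.mul_assoc, mul_apply]
  simp [hA]

theorem mulVec_eq_zero_of_posSemidef_sub (hA : A.PosSemidef) {c : ℝ} (hc : 0 < c)
    (hBA : (B - (c : ℂ) • A).PosSemidef) (v : n → ℂ) (hv : B *ᵥ v = 0) : A *ᵥ v = 0 := by
  rw [← hA.dotProduct_mulVec_zero_iff]
  have h1 := hBA.dotProduct_mulVec_nonneg v
  have h2 := hA.dotProduct_mulVec_nonneg v
  rw [sub_mulVec, hv, zero_sub, smul_mulVec, dotProduct_neg, dotProduct_smul, smul_eq_mul] at h1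
  have hc' : (0 : ℂ) < c := by exact_mod_cast hc
  refine le_antisymm ?_ h2
  have h3 : (c : ℂ) * (star v ⬝ᵥ A *ᵥ v) ≤ c * 0 := by
    rw [mul_zero]
    exact neg_nonneg.mp h1
  exact le_of_mul_le_mul_left h3 hc'

/-- With `A (A v) = B u`, one has `‖A v‖² = ⟨v, B u⟩ = ⟨B v, u⟩ = 0`. -/
theorem mulVec_eq_zero_of_supp_le (hA : A.IsHermitian) (hB : B.IsHermitian)
    (h : supp A ≤ supp B) (v : n → ℂ) (hv : B *ᵥ v = 0) : A *ᵥ v = 0 := by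
  obtain ⟨u, hu⟩ := h ⟨A *ᵥ v, rfl⟩
  have hu' : B *ᵥ u = A *ᵥ (A *ᵥ v) := hu
  rw [← dotProduct_star_self_eq_zero, star_mulVec, hA.eq, ← dotProduct_mulVec,
    ← hu', dotProduct_mulVec, ← hB.eq, ← star_mulVec, hv]
  simp

theorem Diagonalizes.supp_eq_top (h : Diagonalizes B V b) (hb : ∀ j, b j ≠ 0) : supp B = ⊤ := by
  have h1 : B * QChannel.spectralFun V (fun j => (b j)⁻¹) = 1 :=
    (h.mul (h.spectralFun fun j => (b j)⁻¹)).unique (h.one.congr fun j => by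
      simp [hb j])
  refine eq_top_iff.mpr fun v _ => ⟨QChannel.spectralFun V (fun j => (b j)⁻¹) *ᵥ v, ?_⟩
  rw [mulVecLin_apply, mulVec_mulVec, h1, one_mulVec]

theorem Diagonalizes.posDef (h : Diagonalizes B V b) (hb : ∀ j, 0 < b j) : B.PosDef := by
  refine (h.posSemidef fun j => (hb j).le).posDef_iff_isUnit.mpr ?_
  exact IsUnit.of_mul_eq_one _ ((h.mul (h.spectralFun fun j => (b j)⁻¹)).unique
    (h.one.congr fun j => by simp [(hb j).ne']))

theorem Diagonalizes.diagWeight_eq_sum (h : Diagonalizes A U a) (V : Matrix n n ℂ) (j : n) :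
    diagWeight V A j = ∑ i, a i * Complex.normSq ((Vᴴ * U) j i) := by
  have : Vᴴ * A * V = (Vᴴ * U) * diagonal (fun i => (a i : ℂ)) * (Vᴴ * U)ᴴ := by
    rw [h.2, conjTranspose_mul, conjTranspose_conjTranspose]
    simp only [Matrix.mul_assoc]
  rw [diagWeight, this, mul_apply, Complex.re_sum]
  refine Finset.sum_congr rfl fun i _ => ?_
  rw [mul_diagonal, conjTranspose_apply, mul_right_comm, Complex.star_def, Complex.mul_conj]
  rw [← Complex.ofReal_mul, Complex.ofReal_re, mul_comm]

/-- Termwise form of Klein's inequality, from `log t ≤ t - 1` at `t = b / s`. -/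
theorem mul_logb_sub_ge {s b q : ℝ} (hs : 0 ≤ s) (hb : 0 ≤ b) (hq : 0 ≤ q)
    (h : b = 0 → s * q = 0) :
    q * (s - b) / Real.log 2 ≤ s * q * (Real.logb 2 s - Real.logb 2 b) := by
  have hl : 0 < Real.log 2 := Real.log_pos (by norm_num)
  rw [Real.logb, Real.logb, ← sub_div, ← mul_div_assoc]
  refine div_le_div_of_nonneg_right ?_ hl.le
  rcases hb.eq_or_lt with rfl | hb
  · rw [h rfl, sub_zero, mul_comm, h rfl, zero_mul]
  rcases hs.eq_or_lt with rfl | hs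
  · simp only [zero_sub, zero_mul, mul_neg, neg_nonpos]
    positivity
  have h1 : Real.log b - Real.log s ≤ b / s - 1 := by
    rw [← Real.log_div hb.ne' hs.ne']
    exact Real.log_le_sub_one_of_pos (by positivity)
  have h2 : s * (Real.log b - Real.log s) ≤ b - s := by
    calc _ ≤ s * (b / s - 1) := mul_le_mul_of_nonneg_left h1 hs.le
      _ = b - s := by field_simp
  nlinarith

/-- Klein's inequality. -/
theorem crossEntropy_self_le (hA : A.PosSemidef) (hB : B.PosSemidef)
    (htr : A.trace.re = B.trace.re) (hker : ∀ v, B *ᵥ v = 0 → A *ᵥ v = 0) :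
    crossEntropy A A ≤ crossEntropy A B := by
  obtain ⟨U, a, hU⟩ := exists_diagonalizes hA.isHermitian
  obtain ⟨V, b, hV⟩ := exists_diagonalizes hB.isHermitian
  have ha := hU.nonneg hA
  have hb := hV.nonneg hB
  -- The squared overlaps of the two eigenbases form a doubly stochastic matrix, so the linear terms
  -- of the scalar inequality sum to the difference of the traces, which is 0.
  set q : n → n → ℝ := fun j i => Complex.normSq ((Vᴴ * U) j i)
  have hq0 : ∀ j i, 0 ≤ q j i := fun j i => Complex.normSq_nonneg _
  have hrow : ∀ j, ∑ i, q j i = 1 := fun j => by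
    have := hU.one.diagWeight_eq_sum V j
    rw [hV.one.diagWeight_self] at this
    simpa using this.symm
  have hcol : ∀ i, ∑ j, q j i = 1 := fun i => by
    have := hV.one.diagWeight_eq_sum U i
    rw [hU.one.diagWeight_self] at this
    simp only [Pi.one_apply, one_mul] at this
    rw [this]
    refine Finset.sum_congr rfl fun j _ => ?_
    have : (Uᴴ * V) i j = star ((Vᴴ * U) j i) := by
      rw [← conjTranspose_apply, conjTranspose_mul, conjTranspose_conjTranspose]
    rw [this]
    exact (Complex.normSq_conj _).symm
  have hw : ∀ j, diagWeight V A j = ∑ i, a i * q j i := fun j => hU.diagWeight_eq_sum V j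
  have hz : ∀ i j, b j = 0 → a i * q j i = 0 := fun i j hj => by
    have h := hV.diagWeight_eq_zero hker hj
    rw [hw] at h
    exact (Finset.sum_eq_zero_iff_of_nonneg fun i _ => mul_nonneg (ha i) (hq0 j i)).mp h i
      (Finset.mem_univ i)
  have e1 : crossEntropy A A = ∑ j, ∑ i, a i * q j i * -Real.logb 2 (a i) := by
    rw [hU.crossEntropy_eq, Finset.sum_comm]
    refine Finset.sum_congr rfl fun i _ => ?_
    rw [hU.diagWeight_self, ← Finset.sum_mul, ← Finset.mul_sum, hcol, mul_one]
  have e2 : crossEntropy A B = ∑ j, ∑ i, a i * q j i * -Real.logb 2 (b j) := by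
    rw [hV.crossEntropy_eq]
    refine Finset.sum_congr rfl fun j _ => ?_
    rw [hw, Finset.sum_mul]
  have h1 : ∑ j, ∑ i, q j i * (a i - b j) / Real.log 2 ≤
      ∑ j, ∑ i, a i * q j i * (Real.logb 2 (a i) - Real.logb 2 (b j)) :=
    Finset.sum_le_sum fun j _ => Finset.sum_le_sum fun i _ =>
      mul_logb_sub_ge (ha i) (hb j) (hq0 j i) (hz i j)
  have h2 : ∑ j, ∑ i, q j i * (a i - b j) / Real.log 2 = 0 := by
    simp only [← Finset.sum_div, mul_sub, Finset.sum_sub_distrib]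
    rw [Finset.sum_comm]
    simp only [← Finset.sum_mul, hrow, hcol, one_mul]
    rw [← hU.trace_re, ← hV.trace_re, htr, sub_self, zero_div]
  have h3 : ∑ j, ∑ i, a i * q j i * (Real.logb 2 (a i) - Real.logb 2 (b j)) =
      crossEntropy A B - crossEntropy A A := by
    rw [e1, e2, ← Finset.sum_sub_distrib]
    refine Finset.sum_congr rfl fun j _ => ?_
    rw [← Finset.sum_sub_distrib]
    exact Finset.sum_congr rfl fun i _ => by ring
  linarith

theorem crossEntropy_add (A A' B : Matrix n n ℂ) :
    crossEntropy (A + A') B = crossEntropy A B + crossEntropy A' B := by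
  simp only [crossEntropy, Matrix.add_mul, trace_add, Complex.add_re]
  ring

theorem crossEntropy_smul_left (A B : Matrix n n ℂ) (c : ℝ) :
    crossEntropy ((c : ℂ) • A) B = c * crossEntropy A B := by
  simp [crossEntropy]

theorem crossEntropy_sum_left {ι : Type*} (s : Finset ι) (A : ι → Matrix n n ℂ)
    (B : Matrix n n ℂ) : crossEntropy (∑ i ∈ s, A i) B = ∑ i ∈ s, crossEntropy (A i) B := by
  simp [crossEntropy, Finset.sum_mul, trace_sum]

theorem crossEntropy_smul_right (hB : B.IsHermitian) (hker : ∀ v, B *ᵥ v = 0 → A *ᵥ v = 0)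
    {c : ℝ} (hc : 0 < c) :
    crossEntropy A ((c : ℂ) • B) = crossEntropy A B - Real.logb 2 c * A.trace.re := by
  obtain ⟨V, b, hV⟩ := exists_diagonalizes hB
  rw [(hV.smul c).crossEntropy_eq, hV.crossEntropy_eq, ← hV.sum_diagWeight A, Finset.mul_sum,
    ← Finset.sum_sub_distrib]
  refine Finset.sum_congr rfl fun j _ => ?_
  by_cases hj : b j = 0
  · rw [hV.diagWeight_eq_zero hker hj]
    simp
  · rw [Real.logb_mul hc.ne' hj]
    ring

/-- Both second arguments share an eigenbasis, so monotonicity of the scalar logarithm suffices and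
`B` may be singular. -/
theorem crossEntropy_add_smul_one_le (hA : A.PosSemidef) (hB : B.PosSemidef)
    (hker : ∀ v, B *ᵥ v = 0 → A *ᵥ v = 0) {ε : ℝ} (hε : 0 < ε) :
    crossEntropy A (B + (ε : ℂ) • 1) ≤ crossEntropy A B := by
  obtain ⟨V, b, hV⟩ := exists_diagonalizes hB.isHermitian
  have h' := hV.add (hV.one.smul ε)
  rw [h'.crossEntropy_eq, hV.crossEntropy_eq]
  refine Finset.sum_le_sum fun j _ => ?_
  by_cases hj : b j = 0
  · rw [hV.diagWeight_eq_zero hker hj]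
    simp
  · refine mul_le_mul_of_nonneg_left (neg_le_neg ?_) (diagWeight_nonneg V hA j)
    have hb : 0 < b j := lt_of_le_of_ne (hV.nonneg hB j) (Ne.symm hj)
    exact Real.logb_le_logb_of_le (by norm_num) hb (by simp [hε.le])

open scoped Matrix.Norms.L2Operator in
theorem matrixLog_eq_smul_log (hA : A.IsHermitian) :
    matrixLog A = (((Real.log 2)⁻¹ : ℝ) : ℂ) • CFC.log A := by
  obtain ⟨U, a, h⟩ := exists_diagonalizes hA
  refine h.matrixLog.unique (((h.cfc_eq Real.log).smul _).congr fun i => ?_)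
  rw [Real.logb, div_eq_inv_mul]

open scoped MatrixOrder Matrix.Norms.L2Operator in
-- Operator monotonicity of the logarithm, needed because `A` and `B` need not commute.
theorem crossEntropy_anti {C : Matrix n n ℂ} (hC : C.PosSemidef) (hA : A.PosDef) (hAB : (B - A).PosSemidef) :
    crossEntropy C B ≤ crossEntropy C A := by
  have hle : A ≤ B := Matrix.le_iff.mpr hAB
  have hB : B.IsHermitian := by
    have := hAB.isHermitian.add hA.isHermitian
    rwa [sub_add_cancel] at this
  have hlog : (CFC.log B - CFC.log A).PosSemidef :=
    Matrix.le_iff.mp (CFC.log_le_log hle hA.isStrictlyPositive)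
  have h1 := trace_mul_nonneg hC hlog
  rw [crossEntropy, crossEntropy, neg_le_neg_iff, matrixLog_eq_smul_log hA.isHermitian,
    matrixLog_eq_smul_log hB]
  simp only [Matrix.mul_smul, trace_smul, smul_eq_mul, Complex.re_ofReal_mul]
  refine mul_le_mul_of_nonneg_left ?_ (inv_nonneg.mpr (Real.log_nonneg (by norm_num)))
  simp only [Matrix.mul_sub, trace_sub, Complex.sub_re] at h1
  linarith

end CrossEntropy

/-! ### Block diagonal matrices -/

section Block

variable {s d : Type*} [Fintype s] [DecidableEq s] [Fintype d] [DecidableEq d]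

/-- The block diagonal matrix `∑ₓ |x⟩⟨x| ⊗ A x`. -/
def blockDiag (A : s → Matrix d d ℂ) : Matrix (s × d) (s × d) ℂ :=
  (blockDiagonal A).submatrix (Equiv.prodComm s d) (Equiv.prodComm s d)

theorem blockDiag_apply (A : s → Matrix d d ℂ) (i j : s × d) :
    blockDiag A i j = if i.1 = j.1 then A i.1 i.2 j.2 else 0 := rfl

theorem blockDiag_mul (A B : s → Matrix d d ℂ) :
    blockDiag A * blockDiag B = blockDiag fun x => A x * B x := by
  simp only [blockDiag, blockDiagonal_mul, submatrix_mul_equiv]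

theorem blockDiag_conjTranspose (A : s → Matrix d d ℂ) :
    (blockDiag A)ᴴ = blockDiag fun x => (A x)ᴴ := by
  simp only [blockDiag, conjTranspose_submatrix, blockDiagonal_conjTranspose]

theorem blockDiag_diagonal (a : s → d → ℂ) :
    blockDiag (fun x => diagonal (a x)) = diagonal fun i => a i.1 i.2 := by
  ext i j
  obtain ⟨x, i⟩ := i
  obtain ⟨y, j⟩ := j
  simp only [blockDiag_apply, diagonal_apply, Prod.mk.injEq]
  split_ifs <;> simp_all

theorem blockDiag_one : blockDiag (fun _ : s => (1 : Matrix d d ℂ)) = 1 := by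
  have := blockDiag_diagonal (fun (_ : s) (_ : d) => (1 : ℂ))
  simpa using this

theorem Diagonalizes.blockDiag {A U : s → Matrix d d ℂ} {a : s → d → ℝ}
    (h : ∀ x, Diagonalizes (A x) (U x) (a x)) :
    Diagonalizes (blockDiag A) (blockDiag U) fun i => a i.1 i.2 := by
  refine ⟨?_, ?_⟩
  · rw [blockDiag_conjTranspose, blockDiag_mul]
    simp only [(h _).1, blockDiag_one]
  · rw [← blockDiag_diagonal (fun x i => (a x i : ℂ)), blockDiag_conjTranspose, blockDiag_mul,
      blockDiag_mul]
    congr 1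
    funext x
    exact (h x).2

theorem diagWeight_blockDiag (A U : s → Matrix d d ℂ) (i : s × d) :
    diagWeight (blockDiag U) (blockDiag A) i = diagWeight (U i.1) (A i.1) i.2 := by
  rw [diagWeight, blockDiag_conjTranspose, blockDiag_mul, blockDiag_mul, blockDiag_apply,
    if_pos rfl, diagWeight]

theorem crossEntropy_blockDiag (A : s → Matrix d d ℂ) {B : s → Matrix d d ℂ}
    (hB : ∀ x, (B x).IsHermitian) :
    crossEntropy (blockDiag A) (blockDiag B) = ∑ x, crossEntropy (A x) (B x) := by
  choose V b hV using fun x => exists_diagonalizes (hB x)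
  rw [(Diagonalizes.blockDiag hV).crossEntropy_eq, Fintype.sum_prod_type]
  refine Finset.sum_congr rfl fun x _ => ?_
  rw [(hV x).crossEntropy_eq]
  exact Finset.sum_congr rfl fun j _ => by rw [diagWeight_blockDiag]

theorem blockDiag_mulVec_eq_zero_iff (A : s → Matrix d d ℂ) (v : s × d → ℂ) :
    blockDiag A *ᵥ v = 0 ↔ ∀ x, A x *ᵥ (fun j => v (x, j)) = 0 := by
  have : ∀ x i, (blockDiag A *ᵥ v) (x, i) = (A x *ᵥ (fun j => v (x, j))) i := fun x i => by
    simp only [mulVec, dotProduct, Fintype.sum_prod_type, blockDiag_apply]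
    rw [Finset.sum_eq_single x]
    · simp
    · intro y _ hy
      simp [hy.symm]
    · simp
  constructor
  · intro h x
    ext i
    rw [← this, h]
    rfl
  · intro h
    ext ⟨x, i⟩
    rw [this, h]
    rfl

end Block

/-! ### The Holevo quantity in closed form -/

section Holevo

variable {X d : Type*} [Fintype d] [DecidableEq d]

/-- The output state of a channel for a random input. -/
def avgState (W : Channel X d) (p : StdSimplex ℝ X) : State d :=
  ⟨∑ x ∈ p.weights.support, (p.weights x : ℂ) • (W x).1, by
    refine ⟨posSemidef_sum _ fun x _ => ?_, ?_⟩
    · exact (W x).2.1.smul (by exact_mod_cast p.nonneg x)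
    · have h : ∑ x ∈ p.weights.support, p.weights x = 1 := p.total
      simp only [trace_sum, trace_smul, (W _).2.2, smul_eq_mul, mul_one]
      exact_mod_cast h⟩

/-- The mutual information `H(∑ p(x) W(x)) - ∑ p(x) H(W(x))`. -/
def mutualInfo (W : Channel X d) (p : StdSimplex ℝ X) : ℝ :=
  crossEntropy (avgState W p).1 (avgState W p).1 -
    ∑ x ∈ p.weights.support, p.weights x * crossEntropy (W x).1 (W x).1

theorem State.card_pos (σ : State d) : (0 : ℝ) < Fintype.card d := by
  have : Nonempty d := by
    by_contra h
    rw [not_nonempty_iff] at h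
    have := σ.2.2
    simp [trace] at this
  exact_mod_cast Fintype.card_pos

/-- The mixture of a state with the maximally mixed state, with relative weight `ε`. -/
def State.smooth (σ : State d) (ε : ℝ) (hε : 0 ≤ ε) : State d :=
  ⟨(((1 + ε * Fintype.card d)⁻¹ : ℝ) : ℂ) • (σ.1 + (ε : ℂ) • 1), by
    have hpos : 0 < 1 + ε * Fintype.card d := by positivity
    refine ⟨PosSemidef.smul (σ.2.1.add (PosSemidef.one.smul (by exact_mod_cast hε)))
      (by exact_mod_cast (inv_pos.mpr hpos).le), ?_⟩
    rw [trace_smul, trace_add, σ.2.2, trace_smul, trace_one, smul_eq_mul, smul_eq_mul]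
    have : (1 + ε * Fintype.card d : ℂ) ≠ 0 := by exact_mod_cast hpos.ne'
    push_cast
    exact inv_mul_cancel₀ this⟩

theorem State.smooth_diagonalizes (σ : State d) {ε : ℝ} (hε : 0 < ε) :
    ∃ U s, Diagonalizes (σ.smooth ε hε.le).1 U s ∧ ∀ i, 0 < s i := by
  obtain ⟨U, a, h, h0, -⟩ := σ.exists_diagonalizes
  refine ⟨U, _, (h.add (h.one.smul ε)).smul _, fun i => ?_⟩
  have := h0 i
  simp only [Pi.one_apply, mul_one]
  positivity

theorem State.smooth_posDef (σ : State d) {ε : ℝ} (hε : 0 < ε) :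
    (σ.smooth ε hε.le).1.PosDef := by
  obtain ⟨U, s, h, hs⟩ := σ.smooth_diagonalizes hε
  exact h.posDef hs

theorem mulVec_ne_zero_of_posDef {A B : Matrix d d ℂ} (hB : B.PosDef) (v : d → ℂ)
    (hv : B *ᵥ v = 0) : A *ᵥ v = 0 := by
  have hinj := mulVec_injective_of_isUnit hB.isUnit
  have : v = 0 := hinj (by simpa using hv)
  simp [this]

theorem logb_two_one_add_le {x : ℝ} (hx : 0 ≤ x) : Real.logb 2 (1 + x) ≤ x / Real.log 2 := by
  rw [Real.logb]
  refine div_le_div_of_nonneg_right ?_ (Real.log_nonneg (by norm_num))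
  have := Real.log_le_sub_one_of_pos (show 0 < 1 + x by positivity)
  linarith

/-- Cross entropies with respect to a smoothed state, in terms of the unnormalized one. -/
theorem crossEntropy_smooth (ρ σ : State d) {ε : ℝ} (hε : 0 < ε) :
    crossEntropy ρ.1 (σ.smooth ε hε.le).1 ≤
      crossEntropy ρ.1 (σ.1 + (ε : ℂ) • 1) + ε * Fintype.card d / Real.log 2 := by
  have hpos : 0 < 1 + ε * Fintype.card d := by positivity
  have hD : (σ.1 + (ε : ℂ) • 1).PosDef :=
    PosDef.posSemidef_add σ.2.1 (PosDef.one.smul (by exact_mod_cast hε))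
  have h := crossEntropy_smul_right (A := ρ.1) hD.isHermitian
    (fun v hv => mulVec_ne_zero_of_posDef hD v hv) (inv_pos.mpr hpos)
  have e : crossEntropy ρ.1 (σ.smooth ε hε.le).1 = _ := h
  rw [e, ρ.2.2, Complex.one_re, mul_one, Real.logb_inv, sub_neg_eq_add]
  gcongr
  exact logb_two_one_add_le (by positivity)

theorem crossEntropy_avgState (W : Channel X d) (p : StdSimplex ℝ X) (B : Matrix d d ℂ) :
    crossEntropy (avgState W p).1 B =
      ∑ x ∈ p.weights.support, p.weights x * crossEntropy (W x).1 B := by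
  rw [avgState, crossEntropy_sum_left]
  exact Finset.sum_congr rfl fun x _ => crossEntropy_smul_left _ _ _

theorem jointState_eq (W : Channel X d) (p : StdSimplex ℝ X) [DecidableEq p.weights.support] :
    jointState W p =
      blockDiag fun x : p.weights.support => (p.weights x : ℂ) • (W x).1 := by
  ext ⟨x, i⟩ ⟨y, j⟩
  simp only [jointState, Matrix.sum_apply, Matrix.smul_apply, kroneckerMap_apply, single_apply,
    blockDiag_apply, smul_eq_mul, ite_mul, one_mul, zero_mul, mul_ite, mul_zero]
  rw [Finset.sum_eq_single x]
  · simp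
  · intro z _ hz
    simp [hz]
  · simp

theorem inputState_kronecker_eq (p : StdSimplex ℝ X) [DecidableEq p.weights.support]
    (B : Matrix d d ℂ) :
    inputState p ⊗ₖ B = blockDiag fun x : p.weights.support => (p.weights x : ℂ) • B := by
  ext ⟨x, i⟩ ⟨y, j⟩
  simp only [inputState, Matrix.sum_apply, Matrix.smul_apply, kroneckerMap_apply, single_apply,
    blockDiag_apply, smul_eq_mul, mul_ite, mul_zero, mul_one]
  rw [Finset.sum_eq_single x]
  · simp
  · intro z _ hz
    simp [hz]
  · simp

theorem weights_pos (p : StdSimplex ℝ X) (x : p.weights.support) : 0 < p.weights x :=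
  lt_of_le_of_ne (p.nonneg x) (Ne.symm (Finsupp.mem_support_iff.mp x.2))

/-- Both matrices are block diagonal with the same weights, so the terms `p(x) log p(x)` cancel.
Only the cross entropy of the average state still depends on `B`. -/
theorem relEntropy_joint (W : Channel X d) (p : StdSimplex ℝ X) [DecidableEq p.weights.support]
    {B : Matrix d d ℂ} (hB : B.IsHermitian)
    (hker : ∀ x ∈ p.weights.support, ∀ v, B *ᵥ v = 0 → (W x).1 *ᵥ v = 0) :
    (jointState W p * (matrixLog (jointState W p) - matrixLog (inputState p ⊗ₖ B))).trace.re =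
      crossEntropy (avgState W p).1 B -
        ∑ x ∈ p.weights.support, p.weights x * crossEntropy (W x).1 (W x).1 := by
  have h0 : (jointState W p * (matrixLog (jointState W p) -
      matrixLog (inputState p ⊗ₖ B))).trace.re =
      crossEntropy (jointState W p) (inputState p ⊗ₖ B) -
        crossEntropy (jointState W p) (jointState W p) := by
    simp only [crossEntropy, Matrix.mul_sub, trace_sub, Complex.sub_re]
    ring
  have hterm : ∀ (x : p.weights.support) {C : Matrix d d ℂ}, C.IsHermitian →
      (∀ v, C *ᵥ v = 0 → (W x).1 *ᵥ v = 0) →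
      crossEntropy ((p.weights x : ℂ) • (W x).1) ((p.weights x : ℂ) • C) =
        p.weights x * crossEntropy (W x).1 C - p.weights x * Real.logb 2 (p.weights x) := by
    intro x C hC hk
    rw [crossEntropy_smul_left, crossEntropy_smul_right hC hk (weights_pos p x), (W x).2.2,
      Complex.one_re]
    ring
  have hherm : ∀ (x : p.weights.support) {C : Matrix d d ℂ}, C.IsHermitian →
      ((p.weights x : ℂ) • C).IsHermitian := fun x C hC => by
    rw [IsHermitian, conjTranspose_smul, hC.eq, Complex.star_def, Complex.conj_ofReal]
  rw [h0, jointState_eq, inputState_kronecker_eq,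
    crossEntropy_blockDiag _ fun x => hherm x hB,
    crossEntropy_blockDiag _ fun x => hherm x (W x).2.1.isHermitian,
    ← Finset.sum_sub_distrib, crossEntropy_avgState, ← Finset.sum_sub_distrib,
    ← Finset.sum_coe_sort p.weights.support]
  refine Finset.sum_congr rfl fun x _ => ?_
  rw [hterm x hB (hker x x.2), hterm x (W x).2.1.isHermitian fun v hv => hv]
  ring

/-- When the relative entropy is finite, its excess over the mutual information is that of the
average state relative to `σ`, nonnegative by Klein. -/
theorem mutualInfo_le_holevoQuantity (W : Channel X d) (p : StdSimplex ℝ X) :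
    (mutualInfo W p : EReal) ≤ holevoQuantity W p := by
  classical
  refine le_iInf fun σ => ?_
  rw [relEntropy]
  split_ifs with h
  · have hker : ∀ x ∈ p.weights.support, ∀ v, σ.1 *ᵥ v = 0 → (W x).1 *ᵥ v = 0 := by
      intro x hx v hv
      have hH1 : (jointState W p).IsHermitian := by
        rw [jointState_eq]
        choose U a hU using fun x => (W x).exists_diagonalizes
        exact (Diagonalizes.blockDiag fun x : p.weights.support =>
          (hU x).1.smul (p.weights x)).isHermitian
      have hH2 : (inputState p ⊗ₖ σ.1).IsHermitian := by
        rw [inputState_kronecker_eq]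
        obtain ⟨V, b, hV, -⟩ := σ.exists_diagonalizes
        exact (Diagonalizes.blockDiag fun x : p.weights.support =>
          hV.smul (p.weights x)).isHermitian
      have := mulVec_eq_zero_of_supp_le hH1 hH2 (by convert h) (fun i => v i.2) (by
        rw [inputState_kronecker_eq, blockDiag_mulVec_eq_zero_iff]
        intro y
        rw [smul_mulVec, hv, smul_zero])
      rw [jointState_eq, blockDiag_mulVec_eq_zero_iff] at this
      have h2 := this ⟨x, hx⟩
      rw [smul_mulVec] at h2
      have hp : (p.weights x : ℂ) ≠ 0 := by
        exact_mod_cast (weights_pos p ⟨x, hx⟩).ne'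
      exact (smul_eq_zero.mp h2).resolve_left hp
    have e := relEntropy_joint W p σ.2.1.isHermitian hker
    have key : mutualInfo W p ≤ crossEntropy (avgState W p).1 σ.1 -
        ∑ x ∈ p.weights.support, p.weights x * crossEntropy (W x).1 (W x).1 := by
      refine sub_le_sub_right ?_ _
      refine crossEntropy_self_le (avgState W p).2.1 σ.2.1
        (by rw [(avgState W p).2.2, σ.2.2]) fun v hv => ?_
      rw [avgState, sum_mulVec]
      refine Finset.sum_eq_zero fun x hx => ?_
      rw [smul_mulVec, hker x hx v hv, smul_zero]
    rw [← e] at key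
    refine EReal.coe_le_coe_iff.mpr ?_
    convert key
  · exact le_top

/-- The average state is the minimizer; testing with its full-rank smoothing makes the support
condition automatic at arbitrarily small cost. -/
theorem holevoQuantity_le_mutualInfo (W : Channel X d) (p : StdSimplex ℝ X) :
    holevoQuantity W p ≤ mutualInfo W p := by
  classical
  refine le_of_forall_gt fun r hr => ?_
  obtain ⟨r', hr1, hr2⟩ := EReal.lt_iff_exists_real_btwn.mp hr
  refine lt_of_le_of_lt ?_ hr2
  have hr1' : mutualInfo W p < r' := EReal.coe_lt_coe_iff.mp hr1
  have hcard := (avgState W p).card_pos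
  have hl : 0 < Real.log 2 := Real.log_pos (by norm_num)
  obtain ⟨ε, hε, hε2⟩ : ∃ ε : ℝ, 0 < ε ∧
      ε * Fintype.card d / Real.log 2 ≤ r' - mutualInfo W p := by
    refine ⟨(r' - mutualInfo W p) * Real.log 2 / Fintype.card d, ?_, le_of_eq ?_⟩
    · have := sub_pos.mpr hr1'
      positivity
    · field_simp
  set S := avgState W p with hS
  set σ := S.smooth ε hε.le
  have hD := S.smooth_posDef hε
  refine (iInf_le _ σ).trans ?_
  rw [relEntropy, if_pos]
  · have e := relEntropy_joint W p hD.isHermitian fun x _ v hv => mulVec_ne_zero_of_posDef hD v hv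
    have h1 := crossEntropy_smooth S S hε
    have h2 := crossEntropy_add_smul_one_le S.2.1 S.2.1 (fun v hv => hv) hε
    refine EReal.coe_le_coe_iff.mpr ?_
    have key : crossEntropy S.1 σ.1 -
        ∑ x ∈ p.weights.support, p.weights x * crossEntropy (W x).1 (W x).1 ≤ r' := by
      rw [mutualInfo, ← hS] at hε2
      linarith
    rw [← e] at key
    convert key
  · obtain ⟨V, b, hV, hb⟩ := S.smooth_diagonalizes hε
    have h3 : supp (inputState p ⊗ₖ σ.1) = ⊤ := by
      rw [inputState_kronecker_eq]
      refine (Diagonalizes.blockDiag fun x : p.weights.support =>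
        hV.smul (p.weights x)).supp_eq_top fun i => ?_
      exact (mul_pos (weights_pos p i.1) (hb i.2)).ne'
    intro v _
    have := h3 ▸ Submodule.mem_top (x := v)
    convert this

theorem holevoQuantity_eq (W : Channel X d) (p : StdSimplex ℝ X) :
    holevoQuantity W p = mutualInfo W p :=
  le_antisymm (holevoQuantity_le_mutualInfo W p) (mutualInfo_le_holevoQuantity W p)

end Holevo

/-! ### A state that is close to all outputs -/

section Minimax

variable {X d : Type*} [Fintype d] [DecidableEq d]

/-- The distribution `(1 - ε) p + ε δₓ`. -/
def perturb (p : StdSimplex ℝ X) (x : X) (ε : ℝ) (h0 : 0 ≤ ε) (h1 : ε ≤ 1) : StdSimplex ℝ X where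
  weights := (1 - ε) • p.weights + Finsupp.single x ε
  nonneg := add_nonneg (smul_nonneg (sub_nonneg.mpr h1) p.nonneg) (by simpa using h0)
  total := by
    classical
    rw [Finsupp.sum_add_index' (fun _ => rfl) (fun _ _ _ => rfl),
      Finsupp.sum_smul_index (fun _ => rfl), Finsupp.sum_single_index rfl, ← Finsupp.mul_sum,
      p.total]
    ring

/-- Module-valued, to cover both average states and average entropies. -/
theorem sum_perturb {M : Type*} [AddCommGroup M] [Module ℝ M] (p : StdSimplex ℝ X) (x : X)
    (ε : ℝ) (h0 : 0 ≤ ε) (h1 : ε ≤ 1) (F : X → M) :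
    ∑ y ∈ (perturb p x ε h0 h1).weights.support, (perturb p x ε h0 h1).weights y • F y =
      (1 - ε) • ∑ y ∈ p.weights.support, p.weights y • F y + ε • F x := by
  classical
  change ((1 - ε) • p.weights + Finsupp.single x ε).sum (fun y r => r • F y) =
    (1 - ε) • p.weights.sum (fun y r => r • F y) + ε • F x
  rw [Finsupp.sum_add_index' (h := fun y (r : ℝ) => r • F y) (fun _ => zero_smul _ _)
      (fun _ _ _ => add_smul _ _ _),
    Finsupp.sum_smul_index (h := fun y (r : ℝ) => r • F y) (fun _ => zero_smul _ _),
    Finsupp.sum_single_index (h := fun y (r : ℝ) => r • F y) (zero_smul _ _), Finsupp.smul_sum]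
  simp only [mul_smul]

theorem avgState_perturb (W : Channel X d) (p : StdSimplex ℝ X) (x : X)
    (ε : ℝ) (h0 : 0 ≤ ε) (h1 : ε ≤ 1) :
    (avgState W (perturb p x ε h0 h1)).1 =
      ((1 - ε : ℝ) : ℂ) • (avgState W p).1 + (ε : ℂ) • (W x).1 :=
  sum_perturb p x ε h0 h1 fun y => (W y).1

theorem State.one_sub_posSemidef (ρ : State d) : (1 - ρ.1).PosSemidef := by
  obtain ⟨U, a, h, -, -, h1⟩ := ρ.exists_diagonalizes
  exact (h.one.sub h).posSemidef fun i => sub_nonneg.mpr (h1 i)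

/-- The left side is at most the mutual information of the perturbed input: expand its output
entropy linearly in the first argument and apply Klein to the part coming from `p`. -/
theorem mul_crossEntropy_le_of_forall_mutualInfo_le (W : Channel X d) {c : ℝ}
    (hc : ∀ p, mutualInfo W p ≤ c) (p : StdSimplex ℝ X) (x : X) {ε : ℝ} (h0 : 0 < ε)
    (h1 : ε < 1) :
    (1 - ε) * mutualInfo W p + ε * (crossEntropy (W x).1
      (avgState W (perturb p x ε h0.le h1.le)).1 - crossEntropy (W x).1 (W x).1) ≤ c := by
  refine le_trans ?_ (hc (perturb p x ε h0.le h1.le))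
  set q := perturb p x ε h0.le h1.le
  set S := avgState W p with hS
  set T := avgState W q with hT
  have hTS : T.1 = ((1 - ε : ℝ) : ℂ) • S.1 + (ε : ℂ) • (W x).1 :=
    avgState_perturb W p x ε h0.le h1.le
  have e1 : ∑ y ∈ q.weights.support, q.weights y * crossEntropy (W y).1 (W y).1 =
      (1 - ε) * (∑ y ∈ p.weights.support, p.weights y * crossEntropy (W y).1 (W y).1) +
        ε * crossEntropy (W x).1 (W x).1 :=
    sum_perturb p x ε h0.le h1.le fun y => crossEntropy (W y).1 (W y).1
  have e2 : crossEntropy T.1 T.1 =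
      (1 - ε) * crossEntropy S.1 T.1 + ε * crossEntropy (W x).1 T.1 := by
    nth_rw 1 [hTS]
    rw [crossEntropy_add, crossEntropy_smul_left, crossEntropy_smul_left]
  have hker : ∀ v, T.1 *ᵥ v = 0 → S.1 *ᵥ v = 0 :=
    mulVec_eq_zero_of_posSemidef_sub S.2.1 (sub_pos.mpr h1) (by
      rw [hTS, add_sub_cancel_left]
      exact (W x).2.1.smul (by exact_mod_cast h0.le))
  have h2 := crossEntropy_self_le S.2.1 T.2.1 (by rw [S.2.2, T.2.2]) hker
  have h3 := mul_le_mul_of_nonneg_left h2 (sub_nonneg.mpr h1.le)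
  rw [mutualInfo, mutualInfo, ← hT, ← hS, e1, e2]
  linarith

/-- If all mutual informations are at most `c`, some full-rank state has relative entropy
distance at most about `c` from all outputs of the channel. -/
theorem exists_posDef_crossEntropy_le [Nonempty X] (W : Channel X d) {c : ℝ}
    (hc : ∀ p, mutualInfo W p ≤ c) {δ : ℝ} (hδ : 0 < δ) :
    ∃ σ : State d, σ.1.PosDef ∧
      ∀ x, crossEntropy (W x).1 σ.1 - crossEntropy (W x).1 (W x).1 ≤ c + δ := by
  obtain ⟨x₀⟩ := ‹Nonempty X›
  have hne : (Set.range (mutualInfo W)).Nonempty := ⟨_, StdSimplex.single x₀, rfl⟩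
  have hbdd : BddAbove (Set.range (mutualInfo W)) := ⟨c, by rintro _ ⟨p, rfl⟩; exact hc p⟩
  set s := sSup (Set.range (mutualInfo W))
  have hsc : s ≤ c := csSup_le hne (by rintro _ ⟨p, rfl⟩; exact hc p)
  have hs : ∀ p, mutualInfo W p ≤ s := fun p => le_csSup hbdd ⟨p, rfl⟩
  have hl : 0 < Real.log 2 := Real.log_pos (by norm_num)
  set D : ℝ := 1 + 2 * Fintype.card d / Real.log 2 with hDdef
  have hD : 0 < D := by positivity
  obtain ⟨ε, h0, h1, hεD⟩ : ∃ ε : ℝ, 0 < ε ∧ ε < 1 ∧ ε * D ≤ δ := by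
    refine ⟨min (1 / 2) (δ / D), by positivity, (min_le_left _ _).trans_lt (by norm_num), ?_⟩
    rw [← le_div_iff₀ hD]
    exact min_le_right _ _
  -- The gap is `ε ^ 2` because the perturbation inequality is divided by `ε` afterwards, leaving an
  -- error `ε`.
  obtain ⟨_, ⟨p, rfl⟩, hp⟩ := exists_lt_of_lt_csSup hne
    (show s - ε ^ 2 < s by have := pow_pos h0 2; linarith)
  have h2ε : 0 < 2 * ε := by positivity
  set S := avgState W p
  refine ⟨S.smooth (2 * ε) h2ε.le, S.smooth_posDef h2ε, fun x => ?_⟩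
  have k1 := mul_crossEntropy_le_of_forall_mutualInfo_le W hs p x h0 h1
  set T := avgState W (perturb p x ε h0.le h1.le)
  have hTS : T.1 = ((1 - ε : ℝ) : ℂ) • S.1 + (ε : ℂ) • (W x).1 :=
    avgState_perturb W p x ε h0.le h1.le
  have k2 : crossEntropy (W x).1 T.1 - crossEntropy (W x).1 (W x).1 ≤ s + ε := by
    have := mul_le_mul_of_nonneg_left hp.le (sub_nonneg.mpr h1.le)
    have h3 : ε * (crossEntropy (W x).1 T.1 - crossEntropy (W x).1 (W x).1) ≤ ε * (s + ε) := by
      nlinarith [pow_pos h0 3]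
    exact le_of_mul_le_mul_left h3 h0
  have hker : ∀ v, T.1 *ᵥ v = 0 → (W x).1 *ᵥ v = 0 :=
    mulVec_eq_zero_of_posSemidef_sub (W x).2.1 h0 (by
      rw [hTS, add_sub_cancel_right]
      exact S.2.1.smul (by exact_mod_cast (sub_pos.mpr h1).le))
  have k3 := crossEntropy_add_smul_one_le (W x).2.1 T.2.1 hker h0
  -- `T` depends on `x`, but `T + ε ≤ S + 2ε` because the difference is `ε (S + 1 - W x)`; this
  -- yields one state for all `x`.
  have k4 : crossEntropy (W x).1 (S.1 + ((2 * ε : ℝ) : ℂ) • 1) ≤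
      crossEntropy (W x).1 (T.1 + (ε : ℂ) • 1) := by
    refine crossEntropy_anti (W x).2.1
      (PosDef.posSemidef_add T.2.1 (PosDef.one.smul (by exact_mod_cast h0))) ?_
    have e : S.1 + ((2 * ε : ℝ) : ℂ) • 1 - (T.1 + (ε : ℂ) • 1) =
        (ε : ℂ) • (S.1 + (1 - (W x).1)) := by
      rw [hTS]
      push_cast
      module
    rw [e]
    exact PosSemidef.smul (S.2.1.add (W x).one_sub_posSemidef) (by exact_mod_cast h0.le)
  have k5 := crossEntropy_smooth (W x) S h2ε
  have e : ε * D = ε + 2 * ε * Fintype.card d / Real.log 2 := by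
    rw [hDdef]
    ring
  linarith

end Minimax

/-! ### Projections -/

section Projection

variable {n : Type*} [Fintype n] [DecidableEq n] {A P Q U : Matrix n n ℂ} {a : n → ℝ}

theorem Diagonalizes.rank_eq (h : Diagonalizes A U a) :
    A.rank = Fintype.card {i // a i ≠ 0} := by
  have h1 : IsUnit U.det := isUnit_det_of_left_inverse h.1
  have h2 : IsUnit Uᴴ.det := isUnit_det_of_right_inverse h.1
  rw [h.2, rank_mul_eq_left_of_isUnit_det _ _ h2, rank_mul_eq_right_of_isUnit_det _ _ h1,
    rank_diagonal]
  simp only [ne_eq, Complex.ofReal_eq_zero]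

theorem matrix_rank_add_le (P Q : Matrix n n ℂ) : (P + Q).rank ≤ P.rank + Q.rank := by
  refine le_trans (Submodule.finrank_mono (t := P.mulVecLin.range ⊔ Q.mulVecLin.range) ?_)
    (Submodule.finrank_add_le_finrank_add_finrank _ _)
  rw [mulVecLin_add]
  rintro _ ⟨v, rfl⟩
  exact Submodule.add_mem_sup ⟨v, rfl⟩ ⟨v, rfl⟩

theorem sum_ite_ne_zero (a : n → ℝ) :
    ∑ i, (if a i = 0 then (0 : ℝ) else 1) = Fintype.card {i // a i ≠ 0} := by
  rw [Fintype.card_subtype, Finset.card_filter]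
  push_cast
  exact Finset.sum_congr rfl fun i _ => by by_cases h : a i = 0 <;> simp [h]

theorem trace_eq_rank_of_isIdempotentElem (hP : P.IsHermitian) (hPP : P * P = P) :
    P.trace.re = P.rank := by
  obtain ⟨U, a, h⟩ := exists_diagonalizes hP
  rw [h.trace_re, h.rank_eq, ← sum_ite_ne_zero]
  refine Finset.sum_congr rfl fun i _ => ?_
  have h1 := (h.mul h).diagWeight_self i
  rw [hPP, h.diagWeight_self] at h1
  split_ifs with h0
  · exact h0
  · exact (mul_left_cancel₀ h0 (by rw [mul_one]; exact h1)).symm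

theorem posSemidef_of_isIdempotentElem (hP : P.IsHermitian) (hPP : P * P = P) :
    P.PosSemidef := by
  have := posSemidef_conjTranspose_mul_self P
  rwa [hP.eq, hPP] at this

theorem one_sub_posSemidef_of_isIdempotentElem (hP : P.IsHermitian) (hPP : P * P = P) :
    (1 - P).PosSemidef := by
  refine posSemidef_of_isIdempotentElem (isHermitian_one.sub hP) ?_
  rw [Matrix.sub_mul, Matrix.mul_sub, Matrix.mul_sub, hPP]
  simp

/-- Two projections lie below a projection whose trace is at most the sum of their traces. -/
theorem exists_projection_ge (hP : P.IsHermitian) (hPP : P * P = P) (hQ : Q.IsHermitian)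
    (hQQ : Q * Q = Q) : ∃ R : Matrix n n ℂ, R.IsHermitian ∧ R * R = R ∧ (R - P).PosSemidef ∧
      (R - Q).PosSemidef ∧ R.trace.re ≤ P.trace.re + Q.trace.re := by
  -- `R` projects onto the range of `P + Q`, and `N` onto its kernel, which both `P` and `Q`
  -- annihilate. The trace bound is subadditivity of rank.
  obtain ⟨U, a, h⟩ := exists_diagonalizes (hP.add hQ)
  have hR := h.spectralFun fun i => if a i = 0 then 0 else 1
  have hN := h.spectralFun fun i => if a i = 0 then 1 else 0
  set R := spectralFun U fun i => if a i = 0 then 0 else 1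
  set N := spectralFun U fun i => if a i = 0 then 1 else 0
  have hRR : R * R = R := (hR.mul hR).unique (hR.congr fun i => by split_ifs <;> simp)
  have hRN : R + N = 1 := (hR.add hN).unique (h.one.congr fun i => by
    simp only [Pi.one_apply]
    split_ifs <;> simp)
  have hNH : Nᴴ = N := hN.isHermitian
  have hz : ∀ {P Q : Matrix n n ℂ}, P.IsHermitian → P * P = P → Q.IsHermitian → Q * Q = Q →
      Diagonalizes (P + Q) U a → (R - P).PosSemidef := by
    intro P Q hP hPP hQ hQQ h
    have h1 : ((P + Q) * N).trace.re = 0 := by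
      rw [hN.trace_mul]
      refine Finset.sum_eq_zero fun i _ => ?_
      rw [h.diagWeight_self]
      split_ifs with hi <;> simp [hi]
    have hNpos : N.PosSemidef := hN.posSemidef fun i => by split_ifs <;> simp
    have h2 := trace_mul_nonneg (posSemidef_of_isIdempotentElem hP hPP) hNpos
    have h3 := trace_mul_nonneg (posSemidef_of_isIdempotentElem hQ hQQ) hNpos
    rw [Matrix.add_mul, trace_add, Complex.add_re] at h1
    have hNN : N * N = N := (hN.mul hN).unique (hN.congr fun i => by split_ifs <;> simp)
    have e : ((P * N)ᴴ * (P * N)).trace = (P * N).trace := by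
      rw [conjTranspose_mul, hP.eq, hNH, Matrix.mul_assoc, ← Matrix.mul_assoc P, hPP,
        trace_mul_comm, Matrix.mul_assoc, hNN]
    have hpsd := posSemidef_conjTranspose_mul_self (P * N)
    have h4 : ((P * N)ᴴ * (P * N)).trace = 0 := by
      refine Complex.ext ?_ (Complex.nonneg_iff.mp hpsd.trace_nonneg).2.symm
      rw [e, Complex.zero_re]
      linarith
    have hPN : P * N = 0 := trace_conjTranspose_mul_self_eq_zero_iff.mp h4
    have hPR : P * R = P := by
      have : P * (R + N) = P := by rw [hRN, Matrix.mul_one]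
      rwa [Matrix.mul_add, hPN, add_zero] at this
    have hRP : R * P = P := by
      have := congrArg conjTranspose hPR
      rwa [conjTranspose_mul, hP.eq, hR.isHermitian.eq] at this
    refine posSemidef_of_isIdempotentElem (hR.isHermitian.sub hP) ?_
    rw [Matrix.sub_mul, Matrix.mul_sub, Matrix.mul_sub, hRR, hPR, hRP, hPP]
    simp
  refine ⟨R, hR.isHermitian, hRR, hz hP hPP hQ hQQ h, hz hQ hQQ hP hPP (by rwa [add_comm]), ?_⟩
  rw [hR.trace_re, sum_ite_ne_zero, ← h.rank_eq, trace_eq_rank_of_isIdempotentElem hP hPP,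
    trace_eq_rank_of_isIdempotentElem hQ hQQ]
  exact_mod_cast matrix_rank_add_le P Q

end Projection

/-! ### Random coding -/

section Achievability

/-- One-shot coding: codewords and decoding operators are chosen one after the other, each
decoding operator being orthogonal to the previous ones. -/
theorem exists_codewords {J D : Type*} [Fintype J] [Fintype D] [DecidableEq D]
    (w : J → ℝ) (hw : ∀ j, 0 < w j) (hw1 : ∑ j, w j = 1) (ρ : J → State D)
    (P : J → Matrix D D ℂ) (hP : ∀ j, (P j).IsHermitian) (hPP : ∀ j, P j * P j = P j)
    {L β : ℝ} (hL : ∀ j, (P j).trace.re ≤ L) (hβ : 0 ≤ β)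
    (h1 : 1 - 1 / 8 ≤ ∑ j, w j * ((ρ j).1 * P j).trace.re)
    {V : Matrix D D ℂ} {s : D → ℝ} (hV : Diagonalizes (∑ j, (w j : ℂ) • (ρ j).1) V s)
    (h2 : ∑ i with β < s i, s i ≤ 1 / 8) (M : ℕ) (h3 : M * L * β ≤ 1 / 4) :
    ∃ (x : Fin M → J) (E : Fin M → Matrix D D ℂ), (∀ m, (E m).PosSemidef) ∧
      (1 - ∑ m, E m).PosSemidef ∧ ∀ m, 1 / 2 ≤ ((ρ (x m)).1 * E m).trace.re := by
  have hs0 : ∀ i, 0 ≤ s i := hV.nonneg (posSemidef_sum _ fun j _ =>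
    (ρ j).2.1.smul (by exact_mod_cast (hw j).le))
  have hne : Nonempty J := by
    by_contra h
    rw [not_nonempty_iff] at h
    simp at hw1
  have hL0 : 0 ≤ L := by
    obtain ⟨j⟩ := hne
    exact (Complex.nonneg_iff.mp
      (posSemidef_of_isIdempotentElem (hP j) (hPP j)).trace_nonneg).1.trans (hL j)
  suffices H : ∀ k : ℕ, k ≤ M → ∃ (x : Fin k → J) (E : Fin k → Matrix D D ℂ)
      (R : Matrix D D ℂ), (∀ m, (E m).PosSemidef) ∧ R.IsHermitian ∧ R * R = R ∧ ∑ m, E m = R ∧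
        R.trace.re ≤ k * L ∧ ∀ m, 1 / 2 ≤ ((ρ (x m)).1 * E m).trace.re by
    obtain ⟨x, E, R, hE, hR, hRR, hER, -, hx⟩ := H M le_rfl
    exact ⟨x, E, hE, hER ▸ one_sub_posSemidef_of_isIdempotentElem hR hRR, hx⟩
  intro k
  induction k with
  | zero =>
    intro _
    exact ⟨Fin.elim0, Fin.elim0, 0, fun m => m.elim0, isHermitian_zero, by simp, by simp,
      by simp, fun m => m.elim0⟩
  | succ k ih =>
    intro hk
    obtain ⟨x, E, R, hE, hR, hRR, hER, hRL, hx⟩ := ih (by omega)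
    have hRpos := posSemidef_of_isIdempotentElem hR hRR
    have hR1 := one_sub_posSemidef_of_isIdempotentElem hR hRR
    -- On the average state, eigenvalues above `β` contribute at most 1/8, the others at most `β *
    -- Tr R ≤ 1 / 4`.
    have hσ : ∑ j, w j * ((ρ j).1 * R).trace.re ≤ 3 / 8 := by
      have e : ∑ j, w j * ((ρ j).1 * R).trace.re =
          (R * ∑ j, (w j : ℂ) • (ρ j).1).trace.re := by
        rw [trace_mul_comm, Finset.sum_mul, trace_sum, Complex.re_sum]
        exact Finset.sum_congr rfl fun j _ => by simp
      have hle1 : ∀ i, diagWeight V R i ≤ 1 := fun i => by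
        have := diagWeight_nonneg V hR1 i
        rw [diagWeight_sub, hV.one.diagWeight_self, Pi.one_apply] at this
        linarith
      rw [e, hV.trace_mul]
      calc ∑ i, s i * diagWeight V R i
          ≤ ∑ i, ((if β < s i then s i else 0) + β * diagWeight V R i) := by
            refine Finset.sum_le_sum fun i _ => ?_
            have h0 := diagWeight_nonneg V hRpos i
            split_ifs with hi
            · have := mul_le_of_le_one_right (hs0 i) (hle1 i)
              have := mul_nonneg hβ h0
              linarith
            · rw [zero_add]
              exact mul_le_mul_of_nonneg_right (not_lt.mp hi) h0
        _ = ∑ i with β < s i, s i + β * R.trace.re := by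
            rw [Finset.sum_add_distrib, ← Finset.mul_sum, hV.sum_diagWeight, Finset.sum_filter]
        _ ≤ 1 / 8 + 1 / 4 := by
            refine add_le_add h2 (le_trans ?_ h3)
            have hkM : (k : ℝ) ≤ M := by exact_mod_cast (by omega : k ≤ M)
            calc β * R.trace.re ≤ β * (M * L) := mul_le_mul_of_nonneg_left
                  (hRL.trans (mul_le_mul_of_nonneg_right hkM hL0)) hβ
              _ = M * L * β := mul_comm _ _
        _ = 3 / 8 := by norm_num
    -- On average over `j`, the test `P j` beats `R` by at least `7/8 - 3/8 = 1/2`, so some `j`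
    -- does. Since `R' ≥ P j`, the new decoder `R' - R` inherits this gap.
    obtain ⟨j, -, hj⟩ := Finset.exists_le_of_sum_le (s := Finset.univ)
      (f := fun j => w j * (1 / 2))
      (g := fun j => w j * (((ρ j).1 * P j).trace.re - ((ρ j).1 * R).trace.re))
      Finset.univ_nonempty (by
        simp only [mul_sub, Finset.sum_sub_distrib, ← Finset.sum_mul, hw1]
        linarith)
    have hj' := le_of_mul_le_mul_left hj (hw j)
    obtain ⟨R', hR', hRR', hge1, hge2, htr⟩ := exists_projection_ge hR hRR (hP j) (hPP j)
    refine ⟨Fin.snoc x j, Fin.snoc E (R' - R), R', ?_, hR', hRR', ?_, ?_, ?_⟩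
    · refine Fin.lastCases ?_ fun m => ?_
      · simpa using hge1
      · simpa using hE m
    · rw [Fin.sum_univ_castSucc]
      simp [hER]
    · have := hL j
      push_cast
      linarith
    · refine Fin.lastCases ?_ fun m => ?_
      · have h4 := trace_mul_nonneg (ρ j).2.1 hge2
        simp only [Fin.snoc_last, Matrix.mul_sub, trace_sub, Complex.sub_re] at h4 ⊢
        linarith
      · simpa using hx m

/-- A family of tests that is sub-normalized can be completed to a code. -/
theorem exists_code_of_tests {Y D : Type*} [Fintype D] [DecidableEq D] (V : Channel Y D) {M : ℕ}
    (hM : 0 < M) (x : Fin M → Y) (E : Fin M → Matrix D D ℂ) (hE : ∀ m, (E m).PosSemidef)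
    (hE1 : (1 - ∑ m, E m).PosSemidef) (hx : ∀ m, 1 / 2 ≤ ((V (x m)).1 * E m).trace.re) :
    ∃ K : Code Y D, K.size = M ∧ errorProb K V ≤ 1 / 2 := by
  -- The leftover operator is assigned to message 0, which can only raise its success probability.
  have hpos : ∀ m : Fin M, (if m = ⟨0, hM⟩ then 1 - ∑ m, E m else 0).PosSemidef := fun m => by
    split_ifs
    · exact hE1
    · exact PosSemidef.zero
  refine ⟨⟨M, hM, x, fun m => E m + if m = ⟨0, hM⟩ then 1 - ∑ m, E m else 0,
    fun m => (hE m).add (hpos m), ?_⟩, rfl, ?_⟩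
  · rw [Finset.sum_add_distrib, Finset.sum_ite_eq' Finset.univ]
    simp
  · have hM' : (0 : ℝ) < M := by exact_mod_cast hM
    rw [errorProb, one_div_mul_eq_div, div_le_iff₀ hM']
    calc _ ≤ ∑ _m : Fin M, (1 / 2 : ℝ) := Finset.sum_le_sum fun m _ => by
          have := trace_mul_nonneg (V (x m)).2.1 (hpos m)
          have := hx m
          simp only [Matrix.mul_add, trace_add, Complex.add_re]
          linarith
      _ = _ := by simp [mul_comm]

variable {X d : Type*} [Fintype d] [DecidableEq d]

/-- The coding theorem for classical-quantum channels. -/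
theorem exists_code (W : Channel X d) (p : StdSimplex ℝ X) {δ : ℝ} (hδ : 0 < δ) :
    ∃ C : ℝ, ∀ n : ℕ, 0 < n → C / n ≤ 1 / 8 → ∀ M : ℕ, 0 < M →
      M * (2 : ℝ) ^ (-(n * (mutualInfo W p - 2 * δ))) ≤ 1 / 4 →
      ∃ K : Code (Fin n → X) (Fin n → d), K.size = M ∧ errorProb K (W.pow n) ≤ 1 / 2 := by
  classical
  choose U a hU ha0 ha1 hale using fun x => (W x).exists_diagonalizes
  obtain ⟨V, b, hV, hb0, hb1, hble⟩ := (avgState W p).exists_diagonalizes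
  set S := avgState W p with hS
  set C : ℝ := Fintype.card d * (4 / Real.log 2 ^ 2) with hC
  refine ⟨C / δ ^ 2, fun n hn hCn M hM hMle => ?_⟩
  have hn' : (0 : ℝ) < n := by exact_mod_cast hn
  have hCn' : C / (n * δ ^ 2) ≤ 1 / 8 := by
    rwa [div_div, mul_comm] at hCn
  set ι := p.weights.support
  set w : ι → ℝ := fun x => p.weights x with hwdef
  have hwpos : ∀ x, 0 < w x := weights_pos p
  have hw1 : ∑ x, w x = 1 := by
    have : ∑ x ∈ p.weights.support, p.weights x = 1 := p.total
    exact (Finset.sum_coe_sort p.weights.support fun x => p.weights x).trans this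
  set HC : ℝ := ∑ x ∈ p.weights.support, p.weights x * crossEntropy (W x).1 (W x).1 with hHC
  set H : ℝ := crossEntropy S.1 S.1 with hH
  have hI : mutualInfo W p = H - HC := rfl
  -- Keeping conditional eigenvalues at least `α` gives projections of trace at most `α⁻¹`;
  -- eigenvalues of the average state are typically at most `β`, and `α⁻¹ * β = 2^{-n(I-2δ)}` for
  -- the mutual information `I`.
  set α : ℝ := 2 ^ (-(n * (HC + δ))) with hα
  set β : ℝ := 2 ^ (-(n * (H - δ))) with hβ
  have hα0 : 0 < α := by positivity
  have hβ0 : 0 < β := by positivity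
  have hA : ∀ j : Fin n → ι, Diagonalizes (W.pow n fun k => j k).1 (tensorProd fun k => U (j k))
      fun i => ∏ k, a (j k) (i k) := fun j => Diagonalizes.tensorProd fun k => hU (j k)
  have hprod0 : ∀ (j : Fin n → ι) (i : Fin n → d), 0 ≤ ∏ k, a (j k) (i k) := fun j i =>
    Finset.prod_nonneg fun k _ => ha0 _ _
  set P : (Fin n → ι) → Matrix (Fin n → d) (Fin n → d) ℂ := fun j =>
    spectralFun (tensorProd fun k => U (j k))
      fun i => if ∏ k, a (j k) (i k) < α then 0 else 1 with hPdef
  have hP : ∀ j, Diagonalizes (P j) (tensorProd fun k => U (j k))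
      fun i => if ∏ k, a (j k) (i k) < α then 0 else 1 := fun j => (hA j).spectralFun _
  have hPP : ∀ j, P j * P j = P j := fun j =>
    ((hP j).mul (hP j)).unique ((hP j).congr fun i => by split_ifs <;> simp)
  have htrace : ∀ j : Fin n → ι, ∑ i : Fin n → d, ∏ k, a (j k) (i k) = 1 := fun j => by
    rw [← (hA j).trace_re, (W.pow n _).2.2, Complex.one_re]
  have hPL : ∀ j, (P j).trace.re ≤ α⁻¹ := fun j => by
    rw [(hP j).trace_re, inv_eq_one_div, le_div_iff₀ hα0, Finset.sum_mul]
    refine (Finset.sum_le_sum fun i _ => ?_).trans (htrace j).le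
    split_ifs with hi
    · rw [zero_mul]
      exact hprod0 j i
    · rw [one_mul]
      exact not_lt.mp hi
  have hsuccess : 1 - 1 / 8 ≤
      ∑ j : Fin n → ι, (∏ k, w (j k)) * ((W.pow n fun k => j k).1 * P j).trace.re := by
    -- Chebyshev for pairs (letter, eigenvector index), whose mean exponent is `HC`, handles the
    -- randomness of codeword and spectrum together.
    have hcheb := sum_prod_le_of_deviation hn (fun _ (y : ι × d) => w y.1 * a y.1 y.2)
      (fun _ y => -Real.logb 2 (a y.1 y.2)) (fun _ y => mul_nonneg (hwpos _).le (ha0 _ _))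
      (fun _ => by
        rw [Fintype.sum_prod_type]
        simp only [← Finset.mul_sum, ha1, mul_one, hw1])
      (C := C) (fun _ => by
        rw [Fintype.sum_prod_type]
        simp only [mul_assoc, ← Finset.mul_sum]
        calc _ ≤ ∑ x, w x * C := Finset.sum_le_sum fun x _ =>
              mul_le_mul_of_nonneg_left (sum_mul_logb_sq_le (ha0 _) (hale _)) (hwpos x).le
          _ = C := by rw [← Finset.sum_mul, hw1, one_mul])
      hδ (Finset.univ.filter fun y : Fin n → ι × d => ∏ k, a (y k).1 (y k).2 < α) (by
        intro y hy hpos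
        have hapos : ∀ k, 0 < a (y k).1 (y k).2 := fun k =>
          pos_of_mul_pos_right (hpos k) (hwpos _).le
        rw [Finset.mem_filter, prod_eq_two_rpow hapos] at hy
        have h := (Real.rpow_lt_rpow_left_iff (by norm_num)).mp hy.2
        have e : ∑ _k : Fin n, ∑ z : ι × d, w z.1 * a z.1 z.2 * -Real.logb 2 (a z.1 z.2) =
            n * HC := by
          rw [Finset.sum_const, Finset.card_univ, Fintype.card_fin, nsmul_eq_mul,
            Fintype.sum_prod_type, hHC, ← Finset.sum_coe_sort p.weights.support]
          congr 1
          refine Finset.sum_congr rfl fun x _ => ?_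
          rw [(hU x).crossEntropy_eq, Finset.mul_sum]
          refine Finset.sum_congr rfl fun i _ => ?_
          rw [(hU x).diagWeight_self, mul_assoc]
        rw [e, le_abs]
        left
        linarith)
    have e2 : ∑ y : Fin n → ι × d with ∏ k, a (y k).1 (y k).2 < α,
        ∏ k, w (y k).1 * a (y k).1 (y k).2 =
        ∑ j : Fin n → ι, (∏ k, w (j k)) * ∑ i : Fin n → d,
          if ∏ k, a (j k) (i k) < α then ∏ k, a (j k) (i k) else 0 := by
      rw [Finset.sum_filter, ← (Equiv.arrowProdEquivProdArrow (Fin n) (fun _ => ι)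
        (fun _ => d)).symm.sum_comp, Fintype.sum_prod_type]
      refine Finset.sum_congr rfl fun j _ => ?_
      rw [Finset.mul_sum]
      refine Finset.sum_congr rfl fun i _ => ?_
      simp only [Equiv.arrowProdEquivProdArrow_symm_apply, mul_ite, mul_zero,
        Finset.prod_mul_distrib]
    have e3 : ∀ j : Fin n → ι, ((W.pow n fun k => j k).1 * P j).trace.re =
        1 - ∑ i : Fin n → d, if ∏ k, a (j k) (i k) < α then ∏ k, a (j k) (i k) else 0 := by
      intro j
      rw [(hP j).trace_mul, eq_sub_iff_add_eq, ← Finset.sum_add_distrib]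
      refine (Finset.sum_congr rfl fun i _ => ?_).trans (htrace j)
      rw [(hA j).diagWeight_self]
      split_ifs <;> simp
    have hw1n : ∑ j : Fin n → ι, ∏ k, w (j k) = 1 :=
      (sum_prod_mul_sq (fun _ : Fin n => w) (fun _ _ => 0) (fun _ => hw1) (by simp)).1
    simp only [e3, mul_sub, mul_one, Finset.sum_sub_distrib, hw1n]
    rw [e2] at hcheb
    linarith
  have havg : Diagonalizes (∑ j : Fin n → ι, ((∏ k, w (j k) : ℝ) : ℂ) •
      (W.pow n fun k => j k).1) (tensorProd fun _ => V) fun i => ∏ k, b (i k) := by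
    have e : ∑ j : Fin n → ι, ((∏ k, w (j k) : ℝ) : ℂ) • (W.pow n fun k => j k).1 =
        tensorProd fun _ => S.1 := by
      have h := sum_prod_smul_tensorProd (n := n) w fun x : ι => (W x).1
      refine h.trans ?_
      congr 1
      funext _
      exact Finset.sum_coe_sort p.weights.support fun x => (p.weights x : ℂ) • (W x).1
    rw [e]
    exact Diagonalizes.tensorProd fun _ => hV
  have htail : ∑ i : Fin n → d with β < ∏ k, b (i k), ∏ k, b (i k) ≤ 1 / 8 := by
    refine le_trans (sum_prod_le_of_deviation hn (fun _ => b) (fun _ i => -Real.logb 2 (b i))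
      (fun _ => hb0) (fun _ => hb1) (fun _ => sum_mul_logb_sq_le hb0 hble) hδ _ ?_) hCn'
    intro i hi hpos
    rw [Finset.mem_filter, prod_eq_two_rpow hpos] at hi
    have h := (Real.rpow_lt_rpow_left_iff (by norm_num)).mp hi.2
    have e : ∑ _k : Fin n, ∑ j, b j * -Real.logb 2 (b j) = n * H := by
      rw [hH, hV.crossEntropy_eq]
      simp [hV.diagWeight_self]
    rw [e, le_abs]
    right
    linarith
  have hrate : M * α⁻¹ * β ≤ 1 / 4 := by
    refine le_trans (le_of_eq ?_) hMle
    rw [hα, hβ, ← Real.rpow_neg (by norm_num), mul_assoc, ← Real.rpow_add (by norm_num), hI]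
    congr 2
    ring
  obtain ⟨x, E, hE, hE1, hx⟩ := exists_codewords (fun j : Fin n → ι => ∏ k, w (j k))
    (fun j => Finset.prod_pos fun k _ => hwpos _)
    (sum_prod_mul_sq (fun _ : Fin n => w) (fun _ _ => 0) (fun _ => hw1) (by simp)).1
    (fun j => W.pow n fun k => j k) P (fun j => (hP j).isHermitian) hPP hPL hβ0.le hsuccess havg
    htail M hrate
  exact exists_code_of_tests (W.pow n) hM (fun m k => x m k) E hE hE1 hx

end Achievability

/-! ### Capacities -/

section Capacity

theorem errorProb_le_one {Y D : Type*} [Fintype D] [DecidableEq D] (K : Code Y D)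
    (V : Channel Y D) : errorProb K V ≤ 1 := by
  have hM : (0 : ℝ) < K.size := by exact_mod_cast K.size_pos
  rw [errorProb, one_div_mul_eq_div, div_le_one hM]
  calc _ ≤ ∑ _m : Fin K.size, (1 : ℝ) := Finset.sum_le_sum fun m _ => by
        have := trace_mul_nonneg (V (K.encode m)).2.1 (K.povm_posSemidef m)
        linarith
    _ = K.size := by simp

theorem errorProb_mix {Y D : Type*} [Fintype D] [DecidableEq D] {N : ℕ} (γ : Fin N → ℝ)
    (hγ : ∀ i, 0 < γ i) (hsum : ∑ i, γ i = 1) (V : Fin N → Channel Y D) (K : Code Y D) :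
    errorProb K (Channel.mix γ hγ hsum V) = ∑ i, γ i * errorProb K (V i) := by
  have h : ∀ m, 1 - ((Channel.mix γ hγ hsum V (K.encode m)).1 * K.povm m).trace.re =
      ∑ i, γ i * (1 - ((V i (K.encode m)).1 * K.povm m).trace.re) := fun m => by
    simp only [mul_sub, mul_one, Finset.sum_sub_distrib, hsum]
    simp [Channel.mix, Finset.sum_mul, trace_sum]
  simp only [errorProb, h]
  rw [Finset.sum_comm, Finset.mul_sum]
  refine Finset.sum_congr rfl fun i _ => ?_
  rw [← Finset.mul_sum]
  ring

/-- The deficits `1 - e n i` are nonnegative, so each is at most the total deficit divided by `γ i`.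
-/
theorem tendsto_weighted_sum_iff {N : ℕ} {γ : Fin N → ℝ} (hγ : ∀ i, 0 < γ i)
    (hsum : ∑ i, γ i = 1) {e : ℕ → Fin N → ℝ} (he : ∀ n i, e n i ≤ 1) :
    Tendsto (fun n => ∑ i, γ i * e n i) atTop (𝓝 1) ↔
      ∀ i, Tendsto (fun n => e n i) atTop (𝓝 1) := by
  constructor
  · intro h i
    have hlow : ∀ n, 1 - (1 - ∑ i, γ i * e n i) / γ i ≤ e n i := fun n => by
      have h1 : γ i * (1 - e n i) ≤ ∑ i, γ i * (1 - e n i) :=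
        Finset.single_le_sum (f := fun i => γ i * (1 - e n i))
          (fun j _ => mul_nonneg (hγ j).le (sub_nonneg.mpr (he n j))) (Finset.mem_univ i)
      simp only [mul_sub, mul_one, Finset.sum_sub_distrib, hsum] at h1
      have h2 : 1 - e n i ≤ (1 - ∑ i, γ i * e n i) / γ i := by
        rw [le_div_iff₀ (hγ i)]
        linarith
      linarith
    refine tendsto_of_tendsto_of_tendsto_of_le_of_le ?_ tendsto_const_nhds hlow fun n => he n i
    simpa using ((h.const_sub 1).div_const (γ i)).const_sub 1
  · intro h
    have := tendsto_finsetSum Finset.univ fun i _ => (h i).const_mul (γ i)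
    simpa [hsum] using this

/-- The rates for which every sequence of codes has error probability tending to `1`. -/
def strongConverseRates {X d : ℕ → Type*} [∀ n, Fintype (d n)] [∀ n, DecidableEq (d n)]
    (W : ∀ n, Channel (X n) (d n)) : Set ℝ :=
  {R : ℝ | ∀ C : ∀ n, Code (X n) (d n), (R : EReal) ≤ rate C →
    Tendsto (fun n => errorProb (C n) (W n)) atTop (𝓝 1)}

theorem strongConverseCapacity_eq_of_rates {X d : ℕ → Type*} [∀ n, Fintype (d n)]
    [∀ n, DecidableEq (d n)] (W : ∀ n, Channel (X n) (d n)) {c : EReal}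
    (h1 : ∀ R ∈ strongConverseRates W, c ≤ (R : EReal))
    (h2 : ∀ R : ℝ, c < R → R ∈ strongConverseRates W) : strongConverseCapacity W = c := by
  refine le_antisymm ?_ (le_iInf₂ h1)
  refine le_of_forall_gt fun r hr => ?_
  obtain ⟨R, hR1, hR2⟩ := EReal.lt_iff_exists_real_btwn.mp hr
  exact (iInf₂_le R (h2 R hR1)).trans_lt hR2

theorem mem_strongConverseRates_mix {X d : ℕ → Type*} [∀ n, Fintype (d n)]
    [∀ n, DecidableEq (d n)] {N : ℕ} (γ : Fin N → ℝ) (hγ : ∀ i, 0 < γ i) (hsum : ∑ i, γ i = 1)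
    (W : Fin N → ∀ n, Channel (X n) (d n)) (R : ℝ) :
    R ∈ strongConverseRates (fun n => Channel.mix γ hγ hsum fun i => W i n) ↔
      ∀ i, R ∈ strongConverseRates (W i) := by
  have h : ∀ C : ∀ n, Code (X n) (d n),
      Tendsto (fun n => errorProb (C n) (Channel.mix γ hγ hsum fun i => W i n)) atTop (𝓝 1) ↔
        ∀ i, Tendsto (fun n => errorProb (C n) (W i n)) atTop (𝓝 1) := fun C => by
    simp only [errorProb_mix]
    exact tendsto_weighted_sum_iff hγ hsum fun n i => errorProb_le_one _ _
  simp only [strongConverseRates, Set.mem_ofPred_eq, h]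
  exact ⟨fun H i C hC => H C hC i, fun H C hC i => H i C hC⟩

variable {X d : Type*} [Fintype d] [DecidableEq d]

/-- The strong converse: rates above all mutual informations force the error probability to `1`. -/
theorem mem_strongConverseRates_of_lt [Nonempty X] (W : Channel X d) {c R : ℝ}
    (hc : ∀ p, mutualInfo W p ≤ c) (hR : c < R) :
    R ∈ strongConverseRates fun n => W.pow n := by
  intro K hK
  -- One `δ` pays for the choice of `σ`, two for typicality, and the last yields exponential decay.
  obtain ⟨δ, hδ, hδR⟩ : ∃ δ : ℝ, 0 < δ ∧ c + 4 * δ < R :=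
    ⟨(R - c) / 5, by linarith, by linarith⟩
  obtain ⟨σ, hσ, hσc⟩ := exists_posDef_crossEntropy_le W hc hδ
  obtain ⟨C, hC⟩ := exists_le_errorProb W σ hσ hσc hδ
  have hev : ∀ᶠ n : ℕ in atTop,
      ((c + 4 * δ : ℝ) : EReal) < ((1 / (n : ℝ) * Real.logb 2 (K n).size : ℝ) : EReal) :=
    eventually_lt_of_lt_liminf (lt_of_lt_of_le (EReal.coe_lt_coe_iff.mpr hδR) hK)
  have hlow : ∀ᶠ n : ℕ in atTop,
      1 - (C / n + 2 * ((2 : ℝ) ^ (-δ)) ^ n) ≤ errorProb (K n) (W.pow n) := by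
    filter_upwards [hev, eventually_gt_atTop 0] with n hn hn0
    refine le_trans ?_ (hC n hn0 (K n))
    have hn' : (0 : ℝ) < n := by exact_mod_cast hn0
    have hM : (0 : ℝ) < (K n).size := by exact_mod_cast (K n).size_pos
    have h1 := EReal.coe_lt_coe_iff.mp hn
    rw [one_div_mul_eq_div, lt_div_iff₀ hn', Real.lt_logb_iff_rpow_lt (by norm_num) hM] at h1
    have h2 : 2 * (2 : ℝ) ^ (n * (c + δ + 2 * δ)) / (K n).size ≤ 2 * ((2 : ℝ) ^ (-δ)) ^ n := by
      rw [div_le_iff₀ hM, mul_assoc]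
      refine mul_le_mul_of_nonneg_left ?_ zero_le_two
      calc (2 : ℝ) ^ (n * (c + δ + 2 * δ))
          = ((2 : ℝ) ^ (-δ)) ^ n * (2 : ℝ) ^ ((c + 4 * δ) * n) := by
            rw [← Real.rpow_natCast, ← Real.rpow_mul (by norm_num), ← Real.rpow_add (by norm_num)]
            congr 1
            ring
        _ ≤ _ := mul_le_mul_of_nonneg_left h1.le (by positivity)
    linarith
  refine tendsto_of_tendsto_of_tendsto_of_le_of_le' ?_ tendsto_const_nhds hlow
    (Eventually.of_forall fun n => errorProb_le_one _ _)
  have t1 : Tendsto (fun n : ℕ => C / (n : ℝ)) atTop (𝓝 0) := tendsto_const_div_atTop_nhds_zero_nat C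
  have t2 : Tendsto (fun n : ℕ => ((2 : ℝ) ^ (-δ)) ^ n) atTop (𝓝 0) :=
    tendsto_pow_atTop_nhds_zero_of_lt_one (by positivity)
      (Real.rpow_lt_one_of_one_lt_of_neg (by norm_num) (by linarith))
  simpa using (t1.add (t2.const_mul 2)).const_sub 1

/-- The code with a single message. -/
def trivialCode {Y : Type*} {D : Type*} [Fintype D] [DecidableEq D] (y : Y) : Code Y D where
  size := 1
  size_pos := one_pos
  encode _ := y
  povm _ := 1
  povm_posSemidef _ := PosSemidef.one
  povm_sum := by simp

/-- The one-message code has rate 0 and no error. Nonnegativity is later used to bound `⌈2^{nR}⌉` by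
`2 * 2^{nR}`. -/
theorem nonneg_of_mem_strongConverseRates [Nonempty X] (W : Channel X d) {R : ℝ}
    (hR : R ∈ strongConverseRates fun n => W.pow n) : 0 ≤ R := by
  by_contra! hneg
  obtain ⟨x⟩ := ‹Nonempty X›
  have h := hR (fun n => trivialCode fun _ => x) (by
    simp only [rate, trivialCode, Nat.cast_one, Real.logb_one, mul_zero, liminf_const]
    exact_mod_cast hneg.le)
  have h0 : ∀ n, errorProb (trivialCode fun _ => x : Code (Fin n → X) (Fin n → d)) (W.pow n) = 0 :=
    fun n => by simp [errorProb, trivialCode, (W.pow n _).2.2]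
  simp only [h0] at h
  exact zero_ne_one (tendsto_nhds_unique tendsto_const_nhds h)

theorem exists_code_of_size {Y D : Type*} [Fintype D] [DecidableEq D] [Nonempty Y] {M : ℕ}
    (hM : 0 < M) : ∃ K : Code Y D, K.size = M := by
  obtain ⟨y⟩ := ‹Nonempty Y›
  refine ⟨⟨M, hM, fun _ => y, fun m => if m = ⟨0, hM⟩ then 1 else 0, fun m => ?_, by simp⟩, rfl⟩
  split_ifs
  · exact PosSemidef.one
  · exact PosSemidef.zero

theorem mutualInfo_le_of_mem_strongConverseRates [Nonempty X] (W : Channel X d) {R : ℝ}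
    (hR : R ∈ strongConverseRates fun n => W.pow n) (p : StdSimplex ℝ X) :
    mutualInfo W p ≤ R := by
  have hR0 := nonneg_of_mem_strongConverseRates W hR
  by_contra! hlt
  obtain ⟨δ, hδ, hδR⟩ : ∃ δ : ℝ, 0 < δ ∧ mutualInfo W p - 2 * δ = R + δ :=
    ⟨(mutualInfo W p - R) / 3, by linarith, by ring⟩
  obtain ⟨C, hC⟩ := exists_code W p hδ
  set M : ℕ → ℕ := fun n => ⌈(2 : ℝ) ^ (n * R)⌉₊ with hM
  have hMpos : ∀ n, 0 < M n := fun n => Nat.ceil_pos.mpr (by positivity)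
  have hMge : ∀ n : ℕ, (2 : ℝ) ^ (n * R) ≤ M n := fun n => Nat.le_ceil _
  have hMle : ∀ n : ℕ, (M n : ℝ) ≤ 2 * 2 ^ (n * R) := fun n => by
    have h1 : (M n : ℝ) < 2 ^ (n * R) + 1 := Nat.ceil_lt_add_one (by positivity)
    have h2 : (1 : ℝ) ≤ 2 ^ (n * R) := Real.one_le_rpow (by norm_num) (by positivity)
    linarith
  have hgood : ∀ᶠ n : ℕ in atTop, ∃ K : Code (Fin n → X) (Fin n → d),
      K.size = M n ∧ errorProb K (W.pow n) ≤ 1 / 2 := by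
    have t1 : ∀ᶠ n : ℕ in atTop, C / (n : ℝ) < 1 / 8 :=
      (tendsto_const_div_atTop_nhds_zero_nat C).eventually_lt_const (by norm_num)
    have t2 : ∀ᶠ n : ℕ in atTop, ((2 : ℝ) ^ (-δ)) ^ n < 1 / 8 :=
      (tendsto_pow_atTop_nhds_zero_of_lt_one (by positivity)
        (Real.rpow_lt_one_of_one_lt_of_neg (by norm_num) (by linarith))).eventually_lt_const
        (by norm_num)
    filter_upwards [t1, t2, eventually_gt_atTop 0] with n h1 h2 hn
    refine hC n hn h1.le (M n) (hMpos n) ?_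
    rw [hδR]
    calc M n * (2 : ℝ) ^ (-(n * (R + δ))) ≤ 2 * 2 ^ (n * R) * 2 ^ (-(n * (R + δ))) :=
          mul_le_mul_of_nonneg_right (hMle n) (by positivity)
      _ = 2 * ((2 : ℝ) ^ (-δ)) ^ n := by
          rw [mul_assoc, ← Real.rpow_add (by norm_num), ← Real.rpow_natCast (2 ^ (-δ)),
            ← Real.rpow_mul (by norm_num)]
          congr 2
          ring
      _ ≤ 1 / 4 := by linarith
  -- A sequence needs a code at every length: where no good one is available, an arbitrary code of
  -- the same size keeps the rate.
  have hex : ∀ n : ℕ, ∃ K : Code (Fin n → X) (Fin n → d), K.size = M n ∧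
      ((∃ K' : Code (Fin n → X) (Fin n → d), K'.size = M n ∧ errorProb K' (W.pow n) ≤ 1 / 2) →
        errorProb K (W.pow n) ≤ 1 / 2) := fun n => by
    by_cases h : ∃ K' : Code (Fin n → X) (Fin n → d),
        K'.size = M n ∧ errorProb K' (W.pow n) ≤ 1 / 2
    · obtain ⟨K', h1, h2⟩ := h
      exact ⟨K', h1, fun _ => h2⟩
    · obtain ⟨K, hK⟩ := exists_code_of_size (Y := Fin n → X) (D := Fin n → d) (hMpos n)
      exact ⟨K, hK, fun h' => absurd h' h⟩
  choose K hK hKerr using hex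
  have hlim := hR K (by
    refine le_liminf_of_le (by isBoundedDefault) ?_
    filter_upwards [eventually_gt_atTop 0] with n hn
    have hn' : (0 : ℝ) < n := by exact_mod_cast hn
    have hMn : (0 : ℝ) < M n := by exact_mod_cast hMpos n
    refine EReal.coe_le_coe_iff.mpr ?_
    rw [hK, one_div_mul_eq_div, le_div_iff₀ hn', Real.le_logb_iff_rpow_le (by norm_num) hMn,
      mul_comm]
    exact hMge n)
  have hle : (1 : ℝ) ≤ 1 / 2 := le_of_tendsto hlim (by
    filter_upwards [hgood] with n hn using hKerr n hn)
  norm_num at hle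

theorem holevoCapacity_le_of_mem_strongConverseRates [Nonempty X] (W : Channel X d) {R : ℝ}
    (hR : R ∈ strongConverseRates fun n => W.pow n) : holevoCapacity W ≤ R :=
  iSup_le fun p => by
    rw [holevoQuantity_eq]
    exact EReal.coe_le_coe_iff.mpr (mutualInfo_le_of_mem_strongConverseRates W hR p)

theorem mem_strongConverseRates_of_holevoCapacity_lt [Nonempty X] (W : Channel X d) {R : ℝ}
    (hR : holevoCapacity W < R) : R ∈ strongConverseRates fun n => W.pow n := by
  obtain ⟨c, hc, hcR⟩ := EReal.lt_iff_exists_real_btwn.mp hR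
  refine mem_strongConverseRates_of_lt W (fun p => ?_) (EReal.coe_lt_coe_iff.mp hcR)
  have h : holevoQuantity W p ≤ c := (le_iSup (holevoQuantity W) p).trans hc.le
  rw [holevoQuantity_eq] at h
  exact EReal.coe_le_coe_iff.mp h

/-- The strong converse capacity of a memoryless channel is its Holevo capacity. -/
theorem strongConverseCapacity_pow [Nonempty X] (W : Channel X d) :
    strongConverseCapacity (fun n => W.pow n) = holevoCapacity W :=
  strongConverseCapacity_eq_of_rates _
    (fun _ hR => holevoCapacity_le_of_mem_strongConverseRates W hR)
    fun _ hR => mem_strongConverseRates_of_holevoCapacity_lt W hR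

theorem strongConverseCapacity_mix_pow [Nonempty X] {N : ℕ} (γ : Fin N → ℝ)
    (hγ : ∀ i, 0 < γ i) (hsum : ∑ i, γ i = 1) (W : Fin N → Channel X d) :
    strongConverseCapacity (fun n => Channel.mix γ hγ hsum fun i => (W i).pow n) =
      ⨆ i, holevoCapacity (W i) := by
  have hmix := mem_strongConverseRates_mix γ hγ hsum fun i n => (W i).pow n
  refine strongConverseCapacity_eq_of_rates _ (fun R hR => iSup_le fun i =>
    holevoCapacity_le_of_mem_strongConverseRates (W i) ((hmix R).mp hR i)) fun R hR =>
    (hmix R).mpr fun i => mem_strongConverseRates_of_holevoCapacity_lt (W i)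
      ((le_iSup (fun i => holevoCapacity (W i)) i).trans_lt hR)

end Capacity

end QChannel

end

theorem mainTheorem6 {X d : Type*} [Nonempty X] [Fintype d] [DecidableEq d]
    {K : ℕ} (γ : Fin K → ℝ) (hγ : ∀ i, 0 < γ i) (hsum : ∑ i, γ i = 1)
    (W : Fin K → QChannel.Channel X d) :
    QChannel.strongConverseCapacity
        (fun n => QChannel.Channel.mix γ hγ hsum fun i => (W i).pow n) =
      ⨆ i, QChannel.holevoCapacity (W i) ∧
    QChannel.strongConverseCapacity
        (fun n => QChannel.Channel.mix γ hγ hsum fun i => (W i).pow n) =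
      ⨆ i, QChannel.strongConverseCapacity (fun n => (W i).pow n) ∧
    QChannel.strongConverseCapacity
        (fun n => QChannel.Channel.mix γ hγ hsum fun i => (W i).pow n) =
      ⨆ p : Convexity.StdSimplex ℝ X, ⨆ i, QChannel.holevoQuantity (W i) p := by
  have h := QChannel.strongConverseCapacity_mix_pow γ hγ hsum W
  refine ⟨h, ?_, ?_⟩
  · simp only [h, QChannel.strongConverseCapacity_pow]
  · rw [h, iSup_comm]
    rfl
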